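/- Fix $n\ge 0$. A \emph{tableau} is a filling of the diagram (English notation) of a partition by integers, weakly increasing along rows and strictly increasing down columns; an \emph{affine tableau} (AT) is a tableau with $n$ boxes whose entries are pairwise incongruent mod $n$. $\mathrm{rowword}(T)$ reads the rows from bottom to top, each left to right; $\mathrm{colword}(T)$ reads the columns from left to right, each bottom to top. $a+T$ adds $a$ to all entries, and the product $ST$ of (skew) tableaux is the row insertion tableau of $\mathrm{rowword}(S)\,\mathrm{rowword}(T)$. An \emph{affine word} is a word of $n$ integers that are pairwise incongruent mod $n$. \emph{Sign insertion.} Given an affine word $w$, start with $(x,P)=(w,\emptyset)$, $P$ a single column, and repeat: write $x=za$ and column-insert $a$ into $P$, i.e. append $a$ at the bottom if it exceeds all entries of $P$, and otherwise let $a$ replace the smallest entry $b\ge a$ of $P$; replace $x$ by $z$ in the first case and by $(n+b)\,z$ in the second. This stops when $x$ is empty; the final column is $\mathrm{sgnP}(w)$. For an AT $T$, $\mathrm{sgnP}(T):=\mathrm{sgnP}(\mathrm{rowword}(T))$. Column $Q$ (initially empty) is carried along: after step $c$, with $k$ maximal such that the top $k$ entries of $P$ agree with those of $\mathrm{sgnP}(w)$,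 append copies of $c$ to $Q$ until $|Q|=k$. Let $d_0=0$ and $d_j=d_{j-1}+|x|$, where $x$ is the word after step $d_{j-1}$; the $j$-th pass consists of the steps $d_{j-1}+1,\dots,d_j$ (after termination nothing changes). For a composition $\eta=(\eta_1,\dots,\eta_r)$ of $n$, $w$ is \emph{$\eta$-word catabolizable} if, for all $j\le r$, $|Q|\ge \eta_1+\dots+\eta_j$ after the $j$-th pass. \emph{Catabolizability.} Let $Q$ be a tableau of shape $\lambda$ and $\eta=(\eta_1,\hat\eta)$ a composition of its number of rows (resp. columns). Let $R$ (resp. $C$) be the partition formed by the first $\eta_1$ rows (resp. columns) of $\lambda$. $T$ is \emph{$(Q,\eta)$-row catabolizable} if $R\subseteq\mathrm{sh}(T)$, $T$ and $Q$ agree on $R$, and, with $T^*$ the skew tableau obtained by removing the boxes of $R$ from $T$, the tableau $(n+T^*_{\text{rows}\le\eta_1})\,T^*_{\text{rows}>\eta_1}$ is $(Q_{\text{rows}>\eta_1},\hat\eta)$-row catabolizable. $T$ is \emph{$(Q,\eta)$-column catabolizable} if $C\subseteq\mathrm{sh}(T)$, $T$ and $Q$ agree on $C$, and, with $T^*$ obtained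 by removing the boxes of $C$ from $T$, the tableau $T^*_{\text{cols}>\eta_1}\,(-n+T^*_{\text{cols}\le\eta_1})$ is $(Q_{\text{cols}>\eta_1},\hat\eta)$-column catabolizable. In both cases $\emptyset$ is the unique $(\emptyset,())$-catabolizable tableau. \emph{Edges.} A Knuth transformation of an affine word exchanges adjacent letters $bac\leftrightarrow bca$ or $acb\leftrightarrow cab$, $a<b<c$; a corotation-edge goes from $w=w_1\cdots w_n$ to $\pi w=(n+w_n)\,w_1\cdots w_{n-1}$; an ascent-edge goes from $w$ to $s_iw>w$ with $1\le i\le n-1$, i.e. it exchanges adjacent letters $w_i>w_{i+1}$. An AT $U$ is \emph{stackable} if stacking its columns on top of each other, from left to right, with $n(c-1)$ added to the entries of the $c$-th column, gives a (strictly increasing) column. \textbf{Proposition.} Let $U$ be a stackable AT of shape $\lambda$, with conjugate shape $\lambda'$, and let $T$ be an AT. Consider the properties (i) $T$ is $(\mathrm{sgnP}(U),\lambda')$-row catabolizable; (ii) $\mathrm{sgnP}(T)=\mathrm{sgnP}(U)$ and $\mathrm{rowword}(T)$ is $\lambda'$-word catabolizable; (iii) $\mathrm{sgnP}(T)=\mathrm{sgnP}(U)$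 and $\mathrm{colword}(T)$ is $\lambda'$-word catabolizable; (iv) $T$ is $(U,1^{\lambda_1})$-column catabolizable; (v) there is a sequence of Knuth transformations and corotation-edges from $\mathrm{rowword}(T)$ to $\mathrm{rowword}(\mathrm{sgnP}(U))$, and there is a sequence of Knuth transformations, corotation-edges and ascent-edges from $\mathrm{rowword}(U)$ to $\mathrm{rowword}(T)$. Then (ii), (iii) and (iv) are equivalent, (i) implies (ii), and any of (i)-(iv) implies (v). -/

import Mathlib

namespace AffineTableaux

/-- A filling of a (possibly skew) diagram by integers, in English notation, given as the list of
its rows from north to south; each row is listed from west to east. -/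
abbrev Filling := List (List ℤ)

/-- The shape of a filling: the list of its row lengths. -/
def shape (T : Filling) : List ℕ := T.map List.length

/-- The filling is a tableau (of partition shape): there are no empty rows, the row lengths weakly
decrease, entries weakly increase along rows and strictly increase down columns. -/
def IsTableau (T : Filling) : Prop :=
  (∀ r ∈ T, r ≠ []) ∧
  (shape T).Pairwise (· ≥ ·) ∧
  (∀ r ∈ T, r.Pairwise (· ≤ ·)) ∧
  T.Pairwise (fun r s => ∀ (j : ℕ) (hr : j < r.length) (hs : j < s.length), r[j] < s[j])

/-- The row reading word: rows are read from south to north, each from west to east. -/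
def rowWord (T : Filling) : List ℤ := T.reverse.flatten

/-- The columns of a filling of partition shape, from west to east; each column is listed from
north to south. -/
def columns (T : Filling) : List (List ℤ) :=
  (List.range (T.headD []).length).map fun j => T.filterMap fun r => r[j]?

/-- The column reading word: columns are read from west to east, each from south to north. -/
def colWord (T : Filling) : List ℤ := ((columns T).map List.reverse).flatten

/-- The conjugate `λ'` of the shape `λ` of a tableau: the list of its column lengths. -/
def conjShape (T : Filling) : List ℕ := (columns T).map List.length

/-- An affine tableau (AT) of size `n`: a tableau with `n` boxes whose integer entries are pairwise
incongruent modulo `n`. -/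
def IsAffineTableau (n : ℕ) (T : Filling) : Prop :=
  IsTableau T ∧ (rowWord T).length = n ∧
    (rowWord T).Pairwise (fun a b => ¬ a ≡ b [ZMOD (n : ℤ)])

/-- The filling `a + T`. -/
def translate (a : ℤ) (T : Filling) : Filling := T.map fun r => r.map fun x => a + x

/-! ### Row insertion -/

/-- Insert `a` into a row: `a` replaces the leftmost entry greater than `a`, which is bumped out;
if there is no such entry, `a` is appended and nothing is bumped. -/
def insertIntoRow (a : ℤ) : List ℤ → List ℤ × Option ℤ
  | [] => ([a], none)
  | b :: r => if a < b then (a :: r, some b)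
      else (b :: (insertIntoRow a r).1, (insertIntoRow a r).2)

/-- Row insertion of `a` into a tableau. -/
def rowInsert (a : ℤ) : Filling → Filling
  | [] => [[a]]
  | r :: T =>
    match insertIntoRow a r with
    | (r', none) => r' :: T
    | (r', some b) => r' :: rowInsert b T

/-- The insertion tableau `P(w)` of a word `w`. -/
def insertionTableau (w : List ℤ) : Filling := w.foldl (fun T a => rowInsert a T) []

/-- The product `S T` of two (skew) tableaux: the tableau Knuth equivalent to the concatenation
of their row reading words. -/
def product (S T : Filling) : Filling := insertionTableau (rowWord S ++ rowWord T)

/-! ### Row and column catabolizability -/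

/-- Containment `μ ⊆ ν` of the diagrams of two shapes (missing parts are `0`). -/
def ShapeLE (μ ν : List ℕ) : Prop := ∀ i : ℕ, μ.getD i 0 ≤ ν.getD i 0

/-- `T_μ`: the restriction of `T` to the diagram of `μ`. -/
def restrict (T : Filling) (μ : List ℕ) : Filling := List.zipWith (fun r m => r.take m) T μ

/-- The row catabolism `rcat_R(T)` for a partition `R` with `k` rows: with `T*` the skew tableau
obtained by removing `T_R` from `T`, it is the product of `n +` (the first `k` rows of `T*`) and
the remaining rows of `T*`. -/
def rcat (n : ℕ) (k : ℕ) (R : List ℕ) (T : Filling) : Filling :=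
  let Tstar : Filling := T.mapIdx fun i r => r.drop (R.getD i 0)
  product (translate n (Tstar.take k)) (Tstar.drop k)

/-- `(Q, η)`-row catabolizability. -/
def RowCatabolizable (n : ℕ) : List ℕ → Filling → Filling → Prop
  | [], Q, T => Q = [] ∧ T = []
  | k :: η, Q, T =>
    let R := shape (Q.take k)
    ShapeLE R (shape T) ∧ restrict T R = restrict Q R ∧
      RowCatabolizable n η (Q.drop k) (rcat n k R T)

/-- The part of a filling strictly east of its `k`-th column, where rows that become empty are
kept, so that row indices do not change. -/
def east (k : ℕ) (T : Filling) : Filling := T.map fun r => r.drop k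

/-- The column catabolism `ccat_C(T)` for a partition `C` with `k` columns: with `T*` the skew
tableau obtained by removing `T_C` from `T`, it is the product of the part of `T*` east of the
`k`-th column and `-n +` (the first `k` columns of `T*`). -/
def ccat (n : ℕ) (k : ℕ) (C : List ℕ) (T : Filling) : Filling :=
  product (east k T)
    (translate (-(n : ℤ)) (T.mapIdx fun i r => (r.take k).drop (C.getD i 0)))

/-- `(Q, η)`-column catabolizability. -/
def ColCatabolizable (n : ℕ) : List ℕ → Filling → Filling → Prop
  | [], Q, T => Q = [] ∧ T = []
  | k :: η, Q, T =>
    let C := shape (Q.map fun r => r.take k)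
    ShapeLE C (shape T) ∧ restrict T C = restrict Q C ∧
      ColCatabolizable n η ((east k Q).filter fun r => !r.isEmpty) (ccat n k C T)

/-! ### The sign insertion algorithm -/

/-- Column insertion of `a` into a single column (listed from north to south): `a` replaces the
northernmost entry `≥ a`, which is bumped out (into the second column); if there is no such entry,
`a` is appended at the bottom. -/
def insertIntoColumn (a : ℤ) : List ℤ → List ℤ × Option ℤ
  | [] => ([a], none)
  | p :: P => if a ≤ p then (a :: P, some p)
      else (p :: (insertIntoColumn a P).1, (insertIntoColumn a P).2)

/-- The current word and the current single-column insertion tableau (listed from north to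
south) in the sign insertion algorithm. -/
structure SignState where
  word : List ℤ
  col : List ℤ

/-- One step of the sign insertion algorithm. The last letter of the word is removed and
column-inserted. If a letter `b` is bumped out (a corotation step), `n + b` is put at the front of
the word. Nothing happens once the word is empty. -/
def signStep (n : ℕ) (s : SignState) : SignState :=
  match s.word.getLast? with
  | none => s
  | some a =>
    match insertIntoColumn a s.col with
    | (P', none) => ⟨s.word.dropLast, P'⟩
    | (P', some b) => ⟨((n : ℤ) + b) :: s.word.dropLast, P'⟩

/-- The state of the sign insertion algorithm, run on `w`, after `c` steps. -/
def signState (n : ℕ) (w : List ℤ) (c : ℕ) : SignState := (signStep n)^[c] ⟨w, []⟩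

open Classical in
/-- `sgnP(w)`, as a column listed from north to south: the insertion tableau when the sign
insertion algorithm run on `w` terminates, that is, when the word becomes empty. (It terminates on
every affine word.) -/
noncomputable def signP (n : ℕ) (w : List ℤ) : List ℤ :=
  if h : ∃ c, (signState n w c).word = [] then (signState n w (Nat.find h)).col else []

/-- `sgnP(T) := sgnP(w)` for a word `w` inserting to `T`; the row reading word is such a word. -/
noncomputable def signPTableau (n : ℕ) (T : Filling) : List ℤ := signP n (rowWord T)

/-- The tableau of shape `1^m` with the given column. -/
def columnTableau (P : List ℤ) : Filling := P.map fun a => [a]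

/-! ### Word catabolizability -/

/-- The largest `k` such that the first `k` entries of the two lists agree (and exist). -/
def commonPrefix : List ℤ → List ℤ → ℕ
  | a :: l, b :: m => if a = b then commonPrefix l m + 1 else 0
  | _, _ => 0

/-- The recording tableau (a single column, from north to south) after `c` steps: at the `c`-th
step copies of `c` are appended until its length is the largest `k` for which the top `k` entries
of the current insertion tableau are those of `sgnP(w)`. -/
noncomputable def recording (n : ℕ) (w : List ℤ) : ℕ → List ℕ
  | 0 => []
  | c + 1 => recording n w c ++
      List.replicate
        (commonPrefix (signState n w (c + 1)).col (signP n w) - (recording n w c).length) (c + 1)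

/-- The index of the last step of the `j`-th pass: `d_0 = 0` and `d_{j+1} = d_j + |x|`, where `x`
is the word after step `d_j`. -/
def passEnd (n : ℕ) (w : List ℤ) : ℕ → ℕ
  | 0 => 0
  | j + 1 => passEnd n w j + (signState n w (passEnd n w j)).word.length

/-- `η`-word catabolizability: for every `j ≤ r`, where `η = (η_1, …, η_r)`, the recording tableau
after the `j`-th pass has at least `η_1 + ⋯ + η_j` entries. -/
def WordCatabolizable (n : ℕ) (η : List ℕ) (w : List ℤ) : Prop :=
  ∀ j : ℕ, 1 ≤ j → j ≤ η.length → (η.take j).sum ≤ (recording n w (passEnd n w j)).length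

/-! ### Stackable tableaux -/

/-- The column obtained by stacking the columns of `U` on top of each other, from left to right,
with `n (c - 1)` added to the entries of the `c`-th column. -/
def stack (n : ℕ) (U : Filling) : List ℤ :=
  ((columns U).mapIdx fun c l => l.map fun x => x + (n : ℤ) * (c : ℤ)).flatten

/-- `U` is stackable if stacking its columns gives a (single-column) tableau. -/
def IsStackable (n : ℕ) (U : Filling) : Prop := IsTableau (columnTableau (stack n U))

/-! ### Knuth transformations, corotation-edges and ascent-edges

An element `w` of the extended affine symmetric group is identified with its affine word
`w₁ w₂ ⋯ wₙ`. -/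

/-- Knuth transformations of a word, in both directions. -/
inductive KnuthTransformation : List ℤ → List ℤ → Prop
  | bac (u v : List ℤ) {a b c : ℤ} (hab : a < b) (hbc : b < c) :
      KnuthTransformation (u ++ [b, a, c] ++ v) (u ++ [b, c, a] ++ v)
  | bca (u v : List ℤ) {a b c : ℤ} (hab : a < b) (hbc : b < c) :
      KnuthTransformation (u ++ [b, c, a] ++ v) (u ++ [b, a, c] ++ v)
  | acb (u v : List ℤ) {a b c : ℤ} (hab : a < b) (hbc : b < c) :
      KnuthTransformation (u ++ [a, c, b] ++ v) (u ++ [c, a, b] ++ v)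
  | cab (u v : List ℤ) {a b c : ℤ} (hab : a < b) (hbc : b < c) :
      KnuthTransformation (u ++ [c, a, b] ++ v) (u ++ [a, c, b] ++ v)

/-- The corotation-edge from `w` to `π w`: on words, `w₁ ⋯ wₙ` goes to
`(n + wₙ) w₁ ⋯ wₙ₋₁`. -/
inductive CorotationEdge (n : ℕ) : List ℤ → List ℤ → Prop
  | mk (z : List ℤ) (a : ℤ) : CorotationEdge n (z ++ [a]) (((n : ℤ) + a) :: z)

/-- The ascent-edge from `w` to `sᵢ w`, where `i ∈ {1, …, n - 1}` and `sᵢ w > w`: on words,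
left multiplication by `sᵢ` exchanges `wᵢ` and `wᵢ₊₁`, and (the identity being the decreasing word
`n ⋯ 2 1`) `sᵢ w > w` means `wᵢ > wᵢ₊₁`. -/
inductive AscentEdge : List ℤ → List ℤ → Prop
  | mk (u v : List ℤ) {a b : ℤ} (hab : a < b) :
      AscentEdge (u ++ [b, a] ++ v) (u ++ [a, b] ++ v)

end AffineTableaux

open AffineTableaux

namespace AffineTableaux

/-! All the properties are compared with a single statement about the sign insertion algorithm,
`Catabolizes n η s Q`: from the state `s` the algorithm stops with the column `Q`, and after `j`
passes at least `η₁ + ⋯ + ηⱼ` top entries of `Q` are in place.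

Two monotonicity facts make this manageable. Entries of the column only decrease (`below_signStep`),
so a top entry that has its final value keeps it (`commonPrefix_le_of_later`); hence the recording
column has exactly as many entries as are in place (`length_recording`), and `catabolizes_iff` turns
(ii) into `Catabolizes`. Letters, on the other hand, are only ever raised, so a set `K` of top
entries below all other letters is inert and can be split off (`Final.addPrefix`); conversely,
entries that agree with the final column must be inert (`Final.of_addPrefix`).

A whole pass is a column insertion of the current word, and up to Knuth equivalence of the bumped
word it depends only on the Knuth class of its input (`KnuthEquiv.columnPass`). Row and column
reading words are Knuth equivalent, so (ii) and (iii) agree.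

For (iv), one pass on the row word of a tableau leaves its first column and `n +` the word of the
other columns (`columnPass_rowWord`). Applied to `U`, this gives `sgnP(U) = stack n U`
(`final_stack`). Applied to `T` with first column `K ++ P`, where `K` is the first column of `U`, it
leaves, once the inert `K` is removed, the state with column `P`; up to translation by `n` this is
the column catabolism of `T` (`map_add_append_reverse`). Induction on the columns of `U` gives
`colCatabolizable_iff`.

For (i), a row catabolism is the state in the middle of a pass, after the top rows have been
inserted. Starting the next pass there, rather than at the end of the current one, cannot get
further, whence (i) implies (ii) (`RowCatabolizable.catabolizes`).

For (v), a step of the algorithm, with the column read after the word, consists of Knuth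
transformations and at most one corotation (`later_path`). The path out of `U` is built by the
recursion of (iv): a path for the tail columns survives putting the first column in front, as a
corotated letter can be moved back across it by ascents (`AscentPath.append_left`). -/

/-! ### Knuth equivalence -/

/-- Knuth equivalence of words (with pairwise distinct letters). -/
abbrev KnuthEquiv : List ℤ → List ℤ → Prop := Relation.ReflTransGen KnuthTransformation

theorem KnuthTransformation.symm {w w' : List ℤ} (h : KnuthTransformation w w') :
    KnuthTransformation w' w := by
  cases h with
  | bac u v hab hbc => exact .bca u v hab hbc
  | bca u v hab hbc => exact .bac u v hab hbc
  | acb u v hab hbc => exact .cab u v hab hbc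
  | cab u v hab hbc => exact .acb u v hab hbc

theorem KnuthTransformation.perm {w w' : List ℤ} (h : KnuthTransformation w w') :
    w.Perm w' := by
  cases h with
  | bac u v hab hbc => exact (((List.Perm.swap _ _ _).cons _).append_left u).append_right v
  | bca u v hab hbc => exact (((List.Perm.swap _ _ _).cons _).append_left u).append_right v
  | acb u v hab hbc => exact ((List.Perm.swap _ _ _).append_left u).append_right v
  | cab u v hab hbc => exact ((List.Perm.swap _ _ _).append_left u).append_right v

theorem KnuthTransformation.append {w w' : List ℤ} (h : KnuthTransformation w w')
    (u v : List ℤ) : KnuthTransformation (u ++ w ++ v) (u ++ w' ++ v) := by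
  cases h with
  | bac s t hab hbc => simpa using KnuthTransformation.bac (u ++ s) (t ++ v) hab hbc
  | bca s t hab hbc => simpa using KnuthTransformation.bca (u ++ s) (t ++ v) hab hbc
  | acb s t hab hbc => simpa using KnuthTransformation.acb (u ++ s) (t ++ v) hab hbc
  | cab s t hab hbc => simpa using KnuthTransformation.cab (u ++ s) (t ++ v) hab hbc

theorem KnuthTransformation.map_add {w w' : List ℤ} (h : KnuthTransformation w w') (t : ℤ) :
    KnuthTransformation (w.map (t + ·)) (w'.map (t + ·)) := by
  cases h with
  | bac u v hab hbc =>
    simpa using KnuthTransformation.bac (u.map (t + ·)) (v.map (t + ·))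
      (add_lt_add_right hab t) (add_lt_add_right hbc t)
  | bca u v hab hbc =>
    simpa using KnuthTransformation.bca (u.map (t + ·)) (v.map (t + ·))
      (add_lt_add_right hab t) (add_lt_add_right hbc t)
  | acb u v hab hbc =>
    simpa using KnuthTransformation.acb (u.map (t + ·)) (v.map (t + ·))
      (add_lt_add_right hab t) (add_lt_add_right hbc t)
  | cab u v hab hbc =>
    simpa using KnuthTransformation.cab (u.map (t + ·)) (v.map (t + ·))
      (add_lt_add_right hab t) (add_lt_add_right hbc t)

namespace KnuthEquiv

theorem symm {w w' : List ℤ} (h : KnuthEquiv w w') : KnuthEquiv w' w :=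
  have : Std.Symm KnuthTransformation := ⟨fun _ _ h => KnuthTransformation.symm h⟩
  Relation.ReflTransGen.stdSymm.symm _ _ h

theorem perm {w w' : List ℤ} (h : KnuthEquiv w w') : w.Perm w' := by
  induction h with
  | refl => exact .refl _
  | tail _ h ih => exact ih.trans h.perm

theorem append {w w' : List ℤ} (h : KnuthEquiv w w') (u v : List ℤ) :
    KnuthEquiv (u ++ w ++ v) (u ++ w' ++ v) :=
  Relation.ReflTransGen.lift (fun w => u ++ w ++ v) (fun _ _ h => KnuthTransformation.append h u v)
    _ _ h

theorem append_left {w w' : List ℤ} (h : KnuthEquiv w w') (u : List ℤ) :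
    KnuthEquiv (u ++ w) (u ++ w') := by
  simpa using h.append u []

theorem append_right {w w' : List ℤ} (h : KnuthEquiv w w') (v : List ℤ) :
    KnuthEquiv (w ++ v) (w' ++ v) := by
  simpa using h.append [] v

theorem map_add {w w' : List ℤ} (h : KnuthEquiv w w') (t : ℤ) :
    KnuthEquiv (w.map (t + ·)) (w'.map (t + ·)) :=
  Relation.ReflTransGen.lift (List.map (t + ·)) (fun _ _ h => KnuthTransformation.map_add h t)
    _ _ h

theorem bac_bca {a b c : ℤ} (hab : a < b) (hbc : b < c) (u v : List ℤ) :
    KnuthEquiv (u ++ b :: a :: c :: v) (u ++ b :: c :: a :: v) := by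
  simpa using Relation.ReflTransGen.single (KnuthTransformation.bac u v hab hbc)

theorem acb_cab {a b c : ℤ} (hab : a < b) (hbc : b < c) (u v : List ℤ) :
    KnuthEquiv (u ++ a :: c :: b :: v) (u ++ c :: a :: b :: v) := by
  simpa using Relation.ReflTransGen.single (KnuthTransformation.acb u v hab hbc)

end KnuthEquiv

/-! ### Column insertion -/

section insertIntoColumn

variable {a b c p x : ℤ} {P : List ℤ}

theorem insertIntoColumn_nil : insertIntoColumn a [] = ([a], none) := rfl

theorem insertIntoColumn_cons_of_le (h : a ≤ p) :
    insertIntoColumn a (p :: P) = (a :: P, some p) := by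
  simp [insertIntoColumn, h]

theorem insertIntoColumn_cons_of_lt (h : p < a) :
    insertIntoColumn a (p :: P) =
      (p :: (insertIntoColumn a P).1, (insertIntoColumn a P).2) := by
  simp [insertIntoColumn, not_le.2 h]

theorem insertIntoColumn_perm (a : ℤ) (P : List ℤ) :
    ((insertIntoColumn a P).2.toList ++ (insertIntoColumn a P).1).Perm (a :: P) := by
  induction P with
  | nil => simp [insertIntoColumn_nil]
  | cons p P ih =>
    rcases le_or_gt a p with h | h
    · rw [insertIntoColumn_cons_of_le h]
      exact List.Perm.swap _ _ _
    · rw [insertIntoColumn_cons_of_lt h]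
      exact List.perm_middle.trans ((ih.cons p).trans (List.Perm.swap _ _ _))

theorem mem_insertIntoColumn_self (a : ℤ) (P : List ℤ) : a ∈ (insertIntoColumn a P).1 := by
  induction P with
  | nil => simp [insertIntoColumn_nil]
  | cons p P ih =>
    rcases le_or_gt a p with h | h
    · simp [insertIntoColumn_cons_of_le h]
    · simp [insertIntoColumn_cons_of_lt h, ih]

theorem mem_cons_of_mem_insertIntoColumn (h : x ∈ (insertIntoColumn a P).1) : x ∈ a :: P :=
  (insertIntoColumn_perm a P).subset (List.mem_append_right _ h)

theorem insertIntoColumn_bumped (h : (insertIntoColumn a P).2 = some b) : b ∈ P ∧ a ≤ b := by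
  induction P with
  | nil => simp [insertIntoColumn_nil] at h
  | cons p P ih =>
    rcases le_or_gt a p with hp | hp
    · rw [insertIntoColumn_cons_of_le hp] at h
      obtain rfl : p = b := by simpa using h
      exact ⟨by simp, hp⟩
    · rw [insertIntoColumn_cons_of_lt hp] at h
      exact ⟨List.mem_cons_of_mem _ (ih h).1, (ih h).2⟩

theorem insertIntoColumn_sorted (hP : P.Pairwise (· < ·)) :
    (insertIntoColumn a P).1.Pairwise (· < ·) := by
  induction P with
  | nil => simp [insertIntoColumn_nil]
  | cons p P ih =>
    rw [List.pairwise_cons] at hP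
    rcases le_or_gt a p with h | h
    · rw [insertIntoColumn_cons_of_le h]
      exact List.pairwise_cons.2 ⟨fun q hq => h.trans_lt (hP.1 q hq), hP.2⟩
    · rw [insertIntoColumn_cons_of_lt h]
      refine List.pairwise_cons.2 ⟨fun q hq => ?_, ih hP.2⟩
      rcases List.mem_cons.1 (mem_cons_of_mem_insertIntoColumn hq) with rfl | hq
      · exact h
      · exact hP.1 q hq

/-- The bumped letter is the least entry that is at least the inserted one. -/
theorem exists_bumped_le (hP : P.Pairwise (· < ·)) (hx : x ∈ P) (h : a ≤ x) :
    ∃ b, (insertIntoColumn a P).2 = some b ∧ b ≤ x := by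
  induction P with
  | nil => simp at hx
  | cons p P ih =>
    rw [List.pairwise_cons] at hP
    rcases le_or_gt a p with hp | hp
    · rw [insertIntoColumn_cons_of_le hp]
      refine ⟨p, rfl, ?_⟩
      rcases List.mem_cons.1 hx with rfl | hx
      · exact le_rfl
      · exact (hP.1 x hx).le
    · rw [insertIntoColumn_cons_of_lt hp]
      rcases List.mem_cons.1 hx with rfl | hx
      · omega
      · exact ih hP.2 hx

/-- The larger letter lands strictly further south than the smaller one just inserted. This orders
the bumped letters in `columnPass_acb`. -/
theorem bumped_lt_bumped (hP : P.Pairwise (· < ·)) (hbc : b < c)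
    (hx : (insertIntoColumn c (insertIntoColumn b P).1).2 = some x) :
    ∃ y, (insertIntoColumn b P).2 = some y ∧ y < x := by
  induction P with
  | nil =>
    rw [insertIntoColumn_nil, insertIntoColumn_cons_of_lt hbc, insertIntoColumn_nil] at hx
    simp at hx
  | cons p P ih =>
    rw [List.pairwise_cons] at hP
    rcases le_or_gt b p with hp | hp
    · rw [insertIntoColumn_cons_of_le hp] at hx ⊢
      rw [insertIntoColumn_cons_of_lt hbc] at hx
      exact ⟨p, rfl, hP.1 x (insertIntoColumn_bumped hx).1⟩
    · rw [insertIntoColumn_cons_of_lt hp] at hx ⊢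
      rw [insertIntoColumn_cons_of_lt (hp.trans hbc)] at hx
      exact ih hP.2 hx

/-- Column insertion is a sequence of Knuth transformations. -/
theorem knuthEquiv_insertIntoColumn (hP : P.Pairwise (· < ·)) (ha : a ∉ P) :
    KnuthEquiv (a :: P.reverse)
      ((insertIntoColumn a P).1.reverse ++ (insertIntoColumn a P).2.toList) := by
  induction P with
  | nil => exact .refl
  | cons p P ih =>
    rw [List.mem_cons, not_or] at ha
    rcases le_or_gt a p with h | h
    · rw [insertIntoColumn_cons_of_le h]
      have hap : a < p := lt_of_le_of_ne h ha.1
      clear ih ha h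
      simp only [List.reverse_cons, List.append_assoc, Option.toList_some]
      -- The letter `a` is below the whole column. It passes every letter but the last by `acb ~
      -- cab`, the next letter of the column playing `b`.
      suffices H : ∀ (S : List ℤ) (q : ℤ), a < q → (S ++ [q]).Pairwise (· > ·) →
          KnuthEquiv (a :: (S ++ [q])) (S ++ a :: [q]) from
        H P.reverse p hap (by
          rw [← List.reverse_cons, List.pairwise_reverse]
          exact hP)
      intro S
      induction S using List.reverseRecOn with
      | nil => intro q _ _; exact .refl
      | append_singleton S s ih =>
        intro q hq hS
        have hsq : q < s := by
          rw [List.pairwise_append] at hS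
          exact hS.2.2 s (by simp) q (by simp)
        have h1 := (ih s (hq.trans hsq) (List.pairwise_append.1 hS).1).append_right [q]
        have h2 := KnuthEquiv.acb_cab hq hsq S []
        simp only [List.append_assoc, List.cons_append, List.nil_append] at h1 h2 ⊢
        exact h1.trans h2
    · rw [insertIntoColumn_cons_of_lt h]
      rw [List.pairwise_cons] at hP
      have h1 := (ih hP.2 ha.2).append_right [p]
      simp only [List.reverse_cons]
      refine Relation.ReflTransGen.trans (by simpa using h1) ?_
      cases hb : (insertIntoColumn a P).2 with
      | none => simp; rfl
      | some b =>
        obtain ⟨hbP, hab⟩ := insertIntoColumn_bumped hb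
        have hab : a < b := lt_of_le_of_ne hab fun e => ha.2 (e ▸ hbP)
        have hs := insertIntoColumn_sorted (a := a) hP.2
        have hm := mem_insertIntoColumn_self a P
        have hlt : ∀ q ∈ (insertIntoColumn a P).1, p < q := fun q hq => by
          rcases List.mem_cons.1 (mem_cons_of_mem_insertIntoColumn hq) with rfl | hq
          · exact h
          · exact hP.1 q hq
        -- The bumped `b` must still cross `p`. The top `f` of the new column satisfies `p < f ≤ a <
        -- b` and stands just to their left, so `bca ~ bac` applies.
        cases hI : (insertIntoColumn a P).1 with
        | nil => simp [hI] at hm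
        | cons f F =>
          rw [hI] at hs hm hlt
          have hfa : f ≤ a := by
            rcases List.mem_cons.1 hm with rfl | hm
            · exact le_rfl
            · exact ((List.pairwise_cons.1 hs).1 a hm).le
          have := (KnuthEquiv.bac_bca (hlt f (by simp)) (hfa.trans_lt hab) F.reverse []).symm
          simpa using this

end insertIntoColumn

/-! ### Column insertion of a word -/

/-- The column obtained by column-inserting the letters of a word, from right to left, into a
column, and the word of the letters bumped out, the last of them leftmost. -/
def columnPass : List ℤ → List ℤ → List ℤ × List ℤ
  | [], P => (P, [])
  | a :: x, P =>
    ((insertIntoColumn a (columnPass x P).1).1,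
      (insertIntoColumn a (columnPass x P).1).2.toList ++ (columnPass x P).2)

theorem columnPass_append (u v P : List ℤ) :
    columnPass (u ++ v) P =
      ((columnPass u (columnPass v P).1).1,
        (columnPass u (columnPass v P).1).2 ++ (columnPass v P).2) := by
  induction u with
  | nil => rfl
  | cons a u ih => simp [columnPass, ih]

theorem columnPass_perm (x P : List ℤ) :
    ((columnPass x P).2 ++ (columnPass x P).1).Perm (x ++ P) := by
  induction x with
  | nil => exact .refl _
  | cons a x ih =>
    have h := insertIntoColumn_perm a (columnPass x P).1
    simp only [columnPass, List.cons_append]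
    refine List.Perm.trans ?_ (ih.cons a)
    refine List.Perm.trans ?_ (List.perm_middle (l₁ := (columnPass x P).2))
    refine List.Perm.trans ?_ (h.append_left _)
    rw [← List.append_assoc]
    exact List.perm_append_comm.append_right _

theorem columnPass_sorted (x : List ℤ) {P : List ℤ} (hP : P.Pairwise (· < ·)) :
    (columnPass x P).1.Pairwise (· < ·) := by
  induction x with
  | nil => exact hP
  | cons a x ih => exact insertIntoColumn_sorted ih

theorem knuthEquiv_columnPass {x P : List ℤ} (hP : P.Pairwise (· < ·)) (hx : (x ++ P).Nodup) :
    KnuthEquiv (x ++ P.reverse) ((columnPass x P).1.reverse ++ (columnPass x P).2) := by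
  induction x with
  | nil => simp [columnPass]; rfl
  | cons a x ih =>
    rw [List.cons_append, List.nodup_cons] at hx
    have ha : a ∉ (columnPass x P).1 := fun h =>
      hx.1 ((columnPass_perm x P).subset (List.mem_append_right _ h))
    have h1 := (ih hx.2).append_left [a]
    have h2 := (knuthEquiv_insertIntoColumn (columnPass_sorted x hP) ha).append_right
      (columnPass x P).2
    simp only [columnPass, List.cons_append, List.nil_append, List.append_assoc] at h1 h2 ⊢
    exact h1.trans h2

theorem columnPass_cons_of_forall_lt {p : ℤ} {x : List ℤ} (P : List ℤ) (h : ∀ a ∈ x, p < a) :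
    columnPass x (p :: P) = (p :: (columnPass x P).1, (columnPass x P).2) := by
  induction x with
  | nil => rfl
  | cons a x ih =>
    simp only [List.forall_mem_cons] at h
    simp [columnPass, ih h.2, insertIntoColumn_cons_of_lt h.1]

/-! ### Elementary Knuth relations under a pass -/

section

variable {a b c : ℤ} {P : List ℤ}

/-- A top entry `p < a` is never touched, which gives the induction. Otherwise `a` ends on top, and
the two bumped words are equal or differ by one elementary relation, with `p` among its letters; it
need not be of the original type. -/
theorem columnPass_bac (hP : P.Pairwise (· < ·)) (hab : a < b) (hbc : b < c)
    (hPn : ([a, b, c] ++ P).Nodup) :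
    (columnPass [b, a, c] P).1 = (columnPass [b, c, a] P).1 ∧
      KnuthEquiv (columnPass [b, a, c] P).2 (columnPass [b, c, a] P).2 := by
  have hac := hab.trans hbc
  induction P with
  | nil =>
    simp [columnPass, insertIntoColumn_nil, insertIntoColumn_cons_of_le hac.le,
      insertIntoColumn_cons_of_lt hac, insertIntoColumn_cons_of_lt hab,
      insertIntoColumn_cons_of_le hbc.le, Relation.ReflTransGen.refl]
  | cons p P ih =>
    have hPn' : ([a, b, c] ++ P).Nodup :=
      hPn.sublist (((List.sublist_cons_self p P)).append_left _)
    simp only [List.cons_append, List.nil_append, List.nodup_cons, List.mem_cons, not_or] at hPn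
    rw [List.pairwise_cons] at hP
    obtain ⟨⟨-, -, hap, haP⟩, ⟨-, hbp, hbP⟩, ⟨hcp, hcP⟩, hpP, -⟩ := hPn
    rcases lt_or_gt_of_ne hap with hap | hap
    · rcases lt_or_gt_of_ne hcp with hcp | hcp
      · cases P with
        | nil =>
          simp [columnPass, insertIntoColumn_nil, insertIntoColumn_cons_of_le hac.le,
            insertIntoColumn_cons_of_le hap.le, insertIntoColumn_cons_of_le hcp.le,
            insertIntoColumn_cons_of_lt hac, insertIntoColumn_cons_of_lt hab,
            insertIntoColumn_cons_of_le hbc.le, Relation.ReflTransGen.refl]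
        | cons t P =>
          have hpt : p < t := hP.1 t (by simp)
          simp only [columnPass, insertIntoColumn_cons_of_le hac.le,
            insertIntoColumn_cons_of_le hap.le, insertIntoColumn_cons_of_le hcp.le,
            insertIntoColumn_cons_of_lt hac, insertIntoColumn_cons_of_lt hab,
            insertIntoColumn_cons_of_le (hcp.trans hpt).le,
            insertIntoColumn_cons_of_le ((hbc.trans hcp).trans hpt).le,
            insertIntoColumn_cons_of_le hbc.le, true_and]
          simpa using (KnuthEquiv.acb_cab hcp hpt [] []).symm
      -- As `c` is already in the column when `b` arrives, `b` bumps some `b' ≤ c`; anything bumped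
      -- by `c` itself exceeds `c`.
      · obtain ⟨b', hb', hb'c⟩ := exists_bumped_le (insertIntoColumn_sorted (a := c) hP.2)
          (mem_insertIntoColumn_self c P) hbc.le
        have hpb' : p < b' := by
          rcases List.mem_cons.1 (mem_cons_of_mem_insertIntoColumn
            (insertIntoColumn_bumped hb').1) with rfl | h
          · exact hcp
          · exact hP.1 _ h
        simp only [columnPass, insertIntoColumn_cons_of_le hap.le,
          insertIntoColumn_cons_of_lt hcp, insertIntoColumn_cons_of_lt hac,
          insertIntoColumn_cons_of_lt hab, hb', true_and]
        cases hc : (insertIntoColumn c P).2 with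
        | none => exact .refl
        | some c' =>
          have hc' := insertIntoColumn_bumped hc
          have : b' < c' := hb'c.trans_lt (lt_of_le_of_ne hc'.2 fun e => hcP (e ▸ hc'.1))
          simpa using KnuthEquiv.bac_bca hpb' this [] []
    · rw [columnPass_cons_of_forall_lt (x := [b, a, c]) P
        (by simp [hap, hap.trans hab, hap.trans hac]),
        columnPass_cons_of_forall_lt (x := [b, c, a]) P
        (by simp [hap, hap.trans hab, hap.trans hac])]
      simpa using ih hP.2 hPn'

theorem columnPass_acb (hP : P.Pairwise (· < ·)) (hab : a < b) (hbc : b < c)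
    (hPn : ([a, b, c] ++ P).Nodup) :
    (columnPass [a, c, b] P).1 = (columnPass [c, a, b] P).1 ∧
      KnuthEquiv (columnPass [a, c, b] P).2 (columnPass [c, a, b] P).2 := by
  have hac := hab.trans hbc
  induction P with
  | nil =>
    simp [columnPass, insertIntoColumn_nil, insertIntoColumn_cons_of_le hab.le,
      insertIntoColumn_cons_of_lt hac, insertIntoColumn_cons_of_lt hbc,
      Relation.ReflTransGen.refl]
  | cons p P ih =>
    have hPn' : ([a, b, c] ++ P).Nodup :=
      hPn.sublist (((List.sublist_cons_self p P)).append_left _)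
    simp only [List.cons_append, List.nil_append, List.nodup_cons, List.mem_cons, not_or] at hPn
    rw [List.pairwise_cons] at hP
    obtain ⟨⟨-, -, hap, haP⟩, ⟨-, hbp, hbP⟩, ⟨hcp, hcP⟩, hpP, -⟩ := hPn
    rcases lt_or_gt_of_ne hap with hap | hap
    · rcases lt_or_gt_of_ne hbp with hbp | hbp
      · simp only [columnPass, insertIntoColumn_cons_of_le hbp.le,
          insertIntoColumn_cons_of_lt hbc, insertIntoColumn_cons_of_le hab.le,
          insertIntoColumn_cons_of_lt hac, true_and]
        cases hc : (insertIntoColumn c P).2 with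
        | none => exact .refl
        | some c' =>
          simpa using KnuthEquiv.acb_cab hbp (hP.1 c' (insertIntoColumn_bumped hc).1) [] []
      · have hcp : p < c := hbp.trans hbc
        simp only [columnPass, insertIntoColumn_cons_of_lt hbp,
          insertIntoColumn_cons_of_lt hcp, insertIntoColumn_cons_of_le hap.le,
          insertIntoColumn_cons_of_lt hac, true_and]
        cases hc : (insertIntoColumn c (insertIntoColumn b P).1).2 with
        | none => exact .refl
        | some c' =>
          obtain ⟨b', hb', hlt⟩ := bumped_lt_bumped hP.2 hbc hc
          simpa [hb'] using
            KnuthEquiv.acb_cab (hP.1 b' (insertIntoColumn_bumped hb').1) hlt [] []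
    · rw [columnPass_cons_of_forall_lt (x := [a, c, b]) P
        (by simp [hap, hap.trans hab, hap.trans hac]),
        columnPass_cons_of_forall_lt (x := [c, a, b]) P
        (by simp [hap, hap.trans hab, hap.trans hac])]
      simpa using ih hP.2 hPn'

end

theorem columnPass_congr_middle {m m' u v P : List ℤ}
    (h : (columnPass m (columnPass v P).1).1 = (columnPass m' (columnPass v P).1).1 ∧
      KnuthEquiv (columnPass m (columnPass v P).1).2 (columnPass m' (columnPass v P).1).2) :
    (columnPass (u ++ m ++ v) P).1 = (columnPass (u ++ m' ++ v) P).1 ∧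
      KnuthEquiv (columnPass (u ++ m ++ v) P).2 (columnPass (u ++ m' ++ v) P).2 := by
  simp only [List.append_assoc, columnPass_append, h.1, true_and]
  simpa using h.2.append _ _

/-- Letters to the right of the exchange are inserted before it and letters to the left after it,
into the same column, so only the three exchanged letters matter. -/
theorem KnuthTransformation.columnPass {w w' P : List ℤ} (h : KnuthTransformation w w')
    (hP : P.Pairwise (· < ·)) (hw : (w ++ P).Nodup) :
    (columnPass w P).1 = (columnPass w' P).1 ∧
      KnuthEquiv (columnPass w P).2 (columnPass w' P).2 := by
  have key : ∀ {m u v s : List ℤ}, (u ++ m ++ v ++ P).Nodup → m.Perm s →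
      (s ++ (AffineTableaux.columnPass v P).1).Nodup := fun {m u v s} hn hms => by
    have h1 : (m ++ (v ++ P)).Nodup := by
      rw [List.append_assoc, List.append_assoc] at hn
      exact (List.nodup_append.1 hn).2.1
    have h2 := (hms.append_right (v ++ P)).nodup_iff.1 h1
    rw [← ((columnPass_perm v P).append_left s).nodup_iff] at h2
    exact h2.sublist ((List.sublist_append_right _ _).append_left _)
  have hs := fun v => columnPass_sorted v hP
  cases h with
  | bac u v hab hbc =>
    exact columnPass_congr_middle (columnPass_bac (hs v) hab hbc (key hw (.swap _ _ _)))
  | bca u v hab hbc =>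
    have := columnPass_bac (hs v) hab hbc
      (key hw ((List.Perm.swap _ _ _).cons _ |>.trans (.swap _ _ _)))
    exact columnPass_congr_middle ⟨this.1.symm, this.2.symm⟩
  | acb u v hab hbc =>
    exact columnPass_congr_middle (columnPass_acb (hs v) hab hbc
      (key hw ((List.Perm.swap _ _ _).cons _)))
  | cab u v hab hbc =>
    have := columnPass_acb (hs v) hab hbc
      (key hw ((List.Perm.swap _ _ _).trans ((List.Perm.swap _ _ _).cons _)))
    exact columnPass_congr_middle ⟨this.1.symm, this.2.symm⟩

theorem KnuthEquiv.columnPass {w w' P : List ℤ} (h : KnuthEquiv w w')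
    (hP : P.Pairwise (· < ·)) (hw : (w ++ P).Nodup) :
    (columnPass w P).1 = (columnPass w' P).1 ∧
      KnuthEquiv (columnPass w P).2 (columnPass w' P).2 := by
  induction h with
  | refl => exact ⟨rfl, .refl⟩
  | tail h1 h2 ih =>
    have h3 := h2.columnPass hP (((KnuthEquiv.perm h1).append_right P).nodup_iff.1 hw)
    exact ⟨ih.1.trans h3.1, ih.2.trans h3.2⟩

/-! ### The sign insertion algorithm -/

/-- The letters of a word are pairwise incongruent modulo `n`. -/
abbrev Incongruent (n : ℕ) (l : List ℤ) : Prop := (l.map (· % (n : ℤ))).Nodup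

theorem Incongruent.nodup {n : ℕ} {l : List ℤ} (h : Incongruent n l) : l.Nodup :=
  List.Nodup.of_map _ h

theorem Incongruent.perm {n : ℕ} {l l' : List ℤ} (h : Incongruent n l) (hl : l.Perm l') :
    Incongruent n l' :=
  (hl.map _).nodup_iff.1 h

theorem map_add_emod_self (n : ℕ) (l : List ℤ) :
    (l.map ((n : ℤ) + ·)).map (· % (n : ℤ)) = l.map (· % (n : ℤ)) := by
  simp

/-- The letters of the word and of the column. -/
def SignState.letters (s : SignState) : List ℤ := s.word ++ s.col

/-- The state with the letters of `K` added on top of the column. -/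
def SignState.addPrefix (K : List ℤ) (s : SignState) : SignState := ⟨s.word, K ++ s.col⟩

/-- The state with `t` added to all letters. -/
def SignState.shift (t : ℤ) (s : SignState) : SignState :=
  ⟨s.word.map (t + ·), s.col.map (t + ·)⟩

open SignState

section

variable {n : ℕ} {s s' : SignState} {Q Q' K P : List ℤ}

theorem signStep_nil (P : List ℤ) : signStep n ⟨[], P⟩ = ⟨[], P⟩ := rfl

theorem signStep_concat (x : List ℤ) (a : ℤ) (P : List ℤ) :
    signStep n ⟨x ++ [a], P⟩ =
      ⟨(insertIntoColumn a P).2.toList.map ((n : ℤ) + ·) ++ x, (insertIntoColumn a P).1⟩ := by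
  simp only [signStep, List.getLast?_append, List.getLast?_singleton, Option.some_or,
    List.dropLast_concat]
  rcases insertIntoColumn a P with ⟨P', _ | b⟩ <;> rfl

theorem eq_nil_or_concat (s : SignState) :
    (∃ P, s = ⟨[], P⟩) ∨ ∃ x a P, s = ⟨x ++ [a], P⟩ := by
  obtain ⟨w, P⟩ := s
  rcases List.eq_nil_or_concat w with rfl | ⟨x, a, rfl⟩
  · exact .inl ⟨P, rfl⟩
  · exact .inr ⟨x, a, P, by simp⟩

theorem signStep_iterate_nil (c : ℕ) (P : List ℤ) :
    (signStep n)^[c] ⟨[], P⟩ = ⟨[], P⟩ :=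
  Function.iterate_fixed (signStep_nil P) c

/-- A bumped `b` comes back as `n + b`, so residues are invariant. This keeps the letters distinct,
as the Knuth relations require. -/
theorem letters_signStep_perm (n : ℕ) (s : SignState) :
    ((signStep n s).letters.map (· % (n : ℤ))).Perm (s.letters.map (· % (n : ℤ))) := by
  rcases eq_nil_or_concat s with ⟨P, rfl⟩ | ⟨x, a, P, rfl⟩
  · exact .refl _
  · rw [signStep_concat]
    simp only [letters, List.map_append, map_add_emod_self, List.append_assoc]
    have h := (insertIntoColumn_perm a P).map (· % (n : ℤ))
    rw [List.map_append, List.map_cons] at h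
    refine List.perm_append_comm_assoc _ _ _ |>.trans ?_
    exact h.append_left _

theorem Incongruent.signStep (h : Incongruent n s.letters) :
    Incongruent n (signStep n s).letters :=
  (letters_signStep_perm n s).nodup_iff.2 h

theorem signStep_sorted (h : s.col.Pairwise (· < ·)) :
    (signStep n s).col.Pairwise (· < ·) := by
  rcases eq_nil_or_concat s with ⟨P, rfl⟩ | ⟨x, a, P, rfl⟩
  · exact h
  · rw [signStep_concat]
    exact insertIntoColumn_sorted h

theorem exists_le_of_mem_letters_signStep {a : ℤ} (h : a ∈ (signStep n s).letters) :
    ∃ b ∈ s.letters, b ≤ a := by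
  rcases eq_nil_or_concat s with ⟨P, rfl⟩ | ⟨x, c, P, rfl⟩
  · exact ⟨a, h, le_rfl⟩
  · rw [signStep_concat] at h
    have hp := insertIntoColumn_perm c P
    simp only [letters, List.mem_append, List.mem_map] at h ⊢
    rcases h with (⟨b, hb, rfl⟩ | h) | h
    · have := hp.subset (List.mem_append_left _ hb)
      exact ⟨b, by simpa [or_assoc] using Or.inr this, by omega⟩
    · exact ⟨a, by simp [h], le_rfl⟩
    · have := hp.subset (List.mem_append_right _ h)
      exact ⟨a, by simpa [or_assoc] using Or.inr this, le_rfl⟩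

/-- A letter can only be lost by being bumped, and then the inserted letter, which is no larger, is
in the column. -/
theorem exists_mem_letters_signStep_le {a : ℤ} (h : a ∈ s.letters) :
    ∃ b ∈ (signStep n s).letters, b ≤ a := by
  rcases eq_nil_or_concat s with ⟨P, rfl⟩ | ⟨x, c, P, rfl⟩
  · exact ⟨a, h, le_rfl⟩
  · rw [signStep_concat]
    have hp := insertIntoColumn_perm c P
    simp only [letters, List.mem_append, List.mem_singleton, or_assoc] at h ⊢
    rcases h with h | h
    · exact ⟨a, .inr (.inl h), le_rfl⟩
    · have := hp.symm.subset (List.mem_cons.2 h)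
      rcases List.mem_append.1 this with h | h
      · exact ⟨c, .inr (.inr (mem_insertIntoColumn_self c P)),
          (insertIntoColumn_bumped (by simpa using h)).2⟩
      · exact ⟨a, .inr (.inr h), le_rfl⟩

/-! ### Comparing columns entry by entry -/

/-- The column `Q` is at least as long as `P`, and its entries are at most those of `P`. -/
def Below : List ℤ → List ℤ → Prop
  | _, [] => True
  | [], _ :: _ => False
  | q :: Q, p :: P => q ≤ p ∧ Below Q P

theorem Below.refl : ∀ P : List ℤ, Below P P
  | [] => trivial
  | _ :: P => ⟨le_rfl, Below.refl P⟩

theorem Below.trans : ∀ {P Q R : List ℤ}, Below P Q → Below Q R → Below P R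
  | _, _, [], _, _ => by simp [Below]
  | [], [], _ :: _, _, h => h
  | [], _ :: _, _ :: _, h, _ => h.elim
  | _ :: _, [], _ :: _, _, h => h.elim
  | _ :: _, _ :: _, _ :: _, h, h' => ⟨h.1.trans h'.1, h.2.trans h'.2⟩

theorem below_insertIntoColumn (a : ℤ) (P : List ℤ) : Below (insertIntoColumn a P).1 P := by
  induction P with
  | nil => simp [Below]
  | cons p P ih =>
    rcases le_or_gt a p with h | h
    · rw [insertIntoColumn_cons_of_le h]
      exact ⟨h, .refl P⟩
    · rw [insertIntoColumn_cons_of_lt h]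
      exact ⟨le_rfl, ih⟩

/-- Entrywise `P'` is squeezed between `Q` and `P`, so it agrees with `Q` wherever these two agree.
-/
theorem commonPrefix_le_of_below :
    ∀ {P P' Q : List ℤ}, Below P' P → Below Q P' → commonPrefix P Q ≤ commonPrefix P' Q
  | [], _, _, _, _ => by simp [commonPrefix]
  | _ :: _, _, [], _, _ => by simp [commonPrefix]
  | _ :: _, [], _ :: _, h, _ => h.elim
  | p :: P, p' :: P', q :: Q, h, h' => by
    simp only [commonPrefix]
    split_ifs with h1 h2 h2
    · exact Nat.succ_le_succ (commonPrefix_le_of_below h.2 h'.2)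
    · exact absurd (le_antisymm (h1 ▸ h.1) h'.1) h2
    · omega
    · omega

theorem commonPrefix_append (K P Q : List ℤ) :
    commonPrefix (K ++ P) (K ++ Q) = K.length + commonPrefix P Q := by
  induction K with
  | nil => simp
  | cons k K ih => simp [commonPrefix, ih]; omega

theorem exists_append_of_le_commonPrefix :
    ∀ {k : ℕ} {P Q : List ℤ}, k ≤ commonPrefix P Q →
      ∃ K P' Q', K.length = k ∧ P = K ++ P' ∧ Q = K ++ Q'
  | 0, P, Q, _ => ⟨[], P, Q, rfl, rfl, rfl⟩
  | k + 1, [], Q, h => by simp [commonPrefix] at h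
  | k + 1, _ :: _, [], h => by simp [commonPrefix] at h
  | k + 1, p :: P, q :: Q, h => by
    simp only [commonPrefix] at h
    split_ifs at h with e
    · obtain ⟨K, P', Q', hK, rfl, rfl⟩ := exists_append_of_le_commonPrefix
        (Nat.le_of_succ_le_succ h)
      exact ⟨p :: K, P', Q', by simp [hK], rfl, by simp [e]⟩
    · omega

theorem below_signStep (n : ℕ) (s : SignState) : Below (signStep n s).col s.col := by
  rcases eq_nil_or_concat s with ⟨P, rfl⟩ | ⟨x, a, P, rfl⟩
  · exact .refl _
  · rw [signStep_concat]
    exact below_insertIntoColumn a P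

/-! ### Later states -/

/-- `s'` is reached from `s` in the sign insertion algorithm. -/
def Later (n : ℕ) (s s' : SignState) : Prop := ∃ c, s' = (signStep n)^[c] s

theorem Later.refl (s : SignState) : Later n s s := ⟨0, rfl⟩

theorem Later.trans {s'' : SignState} (h : Later n s s') (h' : Later n s' s'') :
    Later n s s'' := by
  obtain ⟨c, rfl⟩ := h
  obtain ⟨d, rfl⟩ := h'
  exact ⟨d + c, (Function.iterate_add_apply _ _ _ _).symm⟩

theorem later_signStep (n : ℕ) (s : SignState) : Later n s (signStep n s) := ⟨1, rfl⟩

theorem Later.induction {p : SignState → Prop} (h : Later n s s') (hs : p s)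
    (hstep : ∀ t, p t → p (signStep n t)) : p s' := by
  obtain ⟨c, rfl⟩ := h
  induction c with
  | zero => exact hs
  | succ c ih =>
    rw [Function.iterate_succ_apply']
    exact hstep _ ih

theorem Later.below (h : Later n s s') : Below s'.col s.col :=
  h.induction (p := fun t => Below t.col s.col) (.refl _)
    fun t ht => (below_signStep n t).trans ht

theorem Later.incongruent (h : Later n s s') (hs : Incongruent n s.letters) :
    Incongruent n s'.letters :=
  h.induction (p := fun t => Incongruent n t.letters) hs fun _ ht => ht.signStep

theorem Later.length_letters (h : Later n s s') : s'.letters.length = s.letters.length :=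
  h.induction (p := fun t => t.letters.length = s.letters.length) rfl fun t ht => by
    rw [← ht]
    simpa using (letters_signStep_perm n t).length_eq

theorem Later.sorted (h : Later n s s') (hs : s.col.Pairwise (· < ·)) :
    s'.col.Pairwise (· < ·) :=
  h.induction (p := fun t => t.col.Pairwise (· < ·)) hs fun _ ht => signStep_sorted ht

theorem Later.exists_le (h : Later n s s') {a : ℤ} (ha : a ∈ s'.letters) :
    ∃ b ∈ s.letters, b ≤ a :=
  h.induction (p := fun t => ∀ a ∈ t.letters, ∃ b ∈ s.letters, b ≤ a)
    (fun a ha => ⟨a, ha, le_rfl⟩) (fun t ht a ha => by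
      obtain ⟨b, hb, hba⟩ := exists_le_of_mem_letters_signStep ha
      obtain ⟨c, hc, hcb⟩ := ht b hb
      exact ⟨c, hc, hcb.trans hba⟩) a ha

theorem Later.exists_ge (h : Later n s s') {a : ℤ} (ha : a ∈ s.letters) :
    ∃ b ∈ s'.letters, b ≤ a :=
  h.induction (p := fun t => ∃ b ∈ t.letters, b ≤ a)
    ⟨a, ha, le_rfl⟩ (fun t ⟨b, hb, hba⟩ => by
      obtain ⟨c, hc, hcb⟩ := exists_mem_letters_signStep_le (n := n) hb
      exact ⟨c, hc, hcb.trans hba⟩)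

theorem Later.forall_lt (h : Later n s s') (hs : ∀ k ∈ K, ∀ a ∈ s.letters, k < a) :
    ∀ k ∈ K, ∀ a ∈ s'.letters, k < a := fun k hk a ha => by
  obtain ⟨b, hb, hba⟩ := h.exists_le ha
  exact (hs k hk b hb).trans_le hba

/-! ### The result of the algorithm -/

/-- The sign insertion algorithm stops from the state `s` with the column `Q`. -/
def Final (n : ℕ) (s : SignState) (Q : List ℤ) : Prop := Later n s ⟨[], Q⟩

theorem Later.eq_of_nil (h : Later n ⟨[], Q⟩ s) : s = ⟨[], Q⟩ := by
  obtain ⟨c, rfl⟩ := h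
  exact signStep_iterate_nil c Q

theorem Final.later (h : Final n s Q) (h' : Later n s s') : Final n s' Q := by
  obtain ⟨c, hc⟩ := h
  obtain ⟨d, rfl⟩ := h'
  refine ⟨c, ?_⟩
  rw [← Function.iterate_add_apply, add_comm, Function.iterate_add_apply, ← hc,
    signStep_iterate_nil]

theorem final_iff_of_later (h : Later n s s') : Final n s Q ↔ Final n s' Q :=
  ⟨fun h' => h'.later h, fun h' => h.trans h'⟩

theorem Final.unique (h : Final n s Q) (h' : Final n s Q') : Q = Q' :=
  congrArg col (h.later h').eq_of_nil

/-- Termination is by lexicographic descent on the length of the word and the sum of the column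
entries above a common lower bound `L` of all letters. A step without bumping shortens the word; a
bump keeps its length and, letters being distinct, strictly lowers the sum. The bound `L` persists
because letters never decrease. -/
theorem exists_final (hs : Incongruent n s.letters) : ∃ Q, Final n s Q := by
  obtain ⟨L, hL⟩ : ∃ L, ∀ a ∈ s.letters, L ≤ a := by
    generalize s.letters = l
    induction l with
    | nil => exact ⟨0, by simp⟩
    | cons a l ih =>
      obtain ⟨L, hL⟩ := ih
      exact ⟨min a L, List.forall_mem_cons.2
        ⟨min_le_left _ _, fun b hb => (min_le_right _ _).trans (hL b hb)⟩⟩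
  have hcol : ∀ {a b : ℤ} {P : List ℤ}, (insertIntoColumn a P).2 = some b → L ≤ a → a ∉ P →
      ((insertIntoColumn a P).1.map fun x => (x - L).toNat).sum <
        (P.map fun x => (x - L).toNat).sum := fun {a b P} hb hLa ha => by
    have h := ((insertIntoColumn_perm a P).map fun x => (x - L).toNat).sum_eq
    have hab := insertIntoColumn_bumped hb
    have : a ≠ b := fun e => ha (e ▸ hab.1)
    rw [hb] at h
    simp only [Option.toList_some, List.cons_append, List.nil_append, List.map_cons,
      List.sum_cons] at h
    omega
  obtain ⟨m, hm⟩ : ∃ m, s.word.length = m := ⟨_, rfl⟩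
  obtain ⟨k, hk⟩ : ∃ k, (s.col.map fun x => (x - L).toNat).sum = k := ⟨_, rfl⟩
  induction m generalizing s k with
  | zero => exact ⟨s.col, 0, by rw [← List.eq_nil_of_length_eq_zero hm]; rfl⟩
  | succ m ihm =>
    induction k using Nat.strong_induction_on generalizing s with
    | _ k ihk =>
      have hL' : ∀ a ∈ (signStep n s).letters, L ≤ a := fun a ha => by
        obtain ⟨b, hb, hba⟩ := exists_le_of_mem_letters_signStep ha
        exact (hL b hb).trans hba
      suffices ∃ Q, Final n (signStep n s) Q from
        this.imp fun Q hQ => (later_signStep n s).trans hQ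
      rcases eq_nil_or_concat s with ⟨P, rfl⟩ | ⟨x, a, P, rfl⟩
      · simp at hm
      · cases hb : (insertIntoColumn a P).2 with
        | none =>
          refine ihm hs.signStep hL' ?_ _ rfl
          simp only [signStep_concat, hb]
          simpa using hm
        | some b =>
          refine ihk _ ?_ hs.signStep hL' ?_ rfl
          · rw [← hk, signStep_concat]
            refine hcol hb (hL a (by simp [letters])) fun h => ?_
            have := hs.nodup
            simp [letters, List.nodup_append, h] at this
          · simp only [signStep_concat, hb]
            simpa using hm

theorem signP_eq_of_final {w : List ℤ} (h : Final n ⟨w, []⟩ Q) : signP n w = Q := by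
  have hex : ∃ c, (signState n w c).word = [] := h.imp fun c hc => by
    rw [signState, ← hc]
  rw [signP, dif_pos hex]
  refine Final.unique (s := ⟨w, []⟩) ⟨Nat.find hex, ?_⟩ h
  have hw := Nat.find_spec hex
  change _ = signState n w (Nat.find hex)
  generalize signState n w (Nat.find hex) = t at hw
  rw [← hw]

theorem final_signP {w : List ℤ} (h : Incongruent n w) : Final n ⟨w, []⟩ (signP n w) := by
  obtain ⟨Q, hQ⟩ := exists_final (n := n) (s := ⟨w, []⟩) (by simpa [letters] using h)
  rwa [signP_eq_of_final hQ]

theorem commonPrefix_le_of_later (h : Later n s s') (hQ : Final n s Q) :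
    commonPrefix s.col Q ≤ commonPrefix s'.col Q :=
  commonPrefix_le_of_below h.below (hQ.later h).below

/-! ### Passes -/

/-- The effect of one pass of the sign insertion algorithm. -/
def signPass (n : ℕ) (s : SignState) : SignState :=
  ⟨(columnPass s.word s.col).2.map ((n : ℤ) + ·), (columnPass s.word s.col).1⟩

/-- Returning letters queue up in front of `u` and do not interfere with the insertion of `v`.
Allowing `u ≠ []` gives access to states in the middle of a pass. -/
theorem signStep_iterate_append (u v P : List ℤ) :
    (signStep n)^[v.length] ⟨u ++ v, P⟩ =
      ⟨(columnPass v P).2.map ((n : ℤ) + ·) ++ u, (columnPass v P).1⟩ := by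
  induction v generalizing u with
  | nil => simp [columnPass]
  | cons a v ih =>
    have := ih (u ++ [a])
    rw [List.append_assoc, List.singleton_append] at this
    rw [List.length_cons, Function.iterate_succ_apply', this, ← List.append_assoc,
      signStep_concat]
    simp [columnPass]

theorem signPass_eq_iterate (n : ℕ) (s : SignState) :
    signPass n s = (signStep n)^[s.word.length] s := by
  have := signStep_iterate_append (n := n) [] s.word s.col
  rw [List.append_nil, List.nil_append] at this
  exact this.symm

theorem later_signPass (n : ℕ) (s : SignState) : Later n s (signPass n s) :=
  ⟨_, signPass_eq_iterate n s⟩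

theorem later_signPass_iterate (n : ℕ) (s : SignState) (j : ℕ) :
    Later n s ((signPass n)^[j] s) := by
  induction j with
  | zero => exact .refl s
  | succ j ih =>
    rw [Function.iterate_succ_apply']
    exact ih.trans (later_signPass n _)

theorem later_iterate_of_le {c d : ℕ} (h : c ≤ d) :
    Later n ((signStep n)^[c] s) ((signStep n)^[d] s) :=
  ⟨d - c, by rw [← Function.iterate_add_apply, Nat.sub_add_cancel h]⟩

theorem length_word_le_signStep (s : SignState) :
    s.word.length ≤ (signStep n s).word.length + 1 := by
  rcases eq_nil_or_concat s with ⟨P, rfl⟩ | ⟨x, a, P, rfl⟩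
  · simp
  · simp [signStep_concat]

/-- A step removes at most one letter net, so a start delayed by `c` steps shortens the pass by at
most `c` and the pass ends no earlier. -/
theorem Later.signPass (h : Later n s s') : Later n (signPass n s) (signPass n s') := by
  obtain ⟨c, rfl⟩ := h
  rw [signPass_eq_iterate, signPass_eq_iterate, ← Function.iterate_add_apply]
  refine later_iterate_of_le ?_
  induction c with
  | zero => exact le_rfl
  | succ c ih =>
    rw [Function.iterate_succ_apply']
    have := length_word_le_signStep (n := n) ((signStep n)^[c] s)
    omega

theorem Later.signPass_iterate (h : Later n s s') (j : ℕ) :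
    Later n ((AffineTableaux.signPass n)^[j] s) ((AffineTableaux.signPass n)^[j] s') := by
  induction j with
  | zero => exact h
  | succ j ih =>
    rw [Function.iterate_succ_apply', Function.iterate_succ_apply']
    exact ih.signPass

theorem later_signStep_signPass (n : ℕ) (s : SignState) :
    Later n (signStep n s) (signPass n s) := by
  rcases eq_nil_or_concat s with ⟨P, rfl⟩ | ⟨x, a, P, rfl⟩
  · exact .refl _
  · rw [signPass_eq_iterate]
    exact later_iterate_of_le (c := 1) (by simp)

theorem Final.exists_signPass (h : Final n s Q) : ∃ j, (signPass n)^[j] s = ⟨[], Q⟩ := by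
  obtain ⟨c, hc⟩ := h
  have : ∀ c, Later n ((signStep n)^[c] s) ((signPass n)^[c] s) := fun c => by
    induction c with
    | zero => exact .refl _
    | succ c ih =>
      rw [Function.iterate_succ_apply', Function.iterate_succ_apply']
      exact (later_signStep_signPass n _).trans ih.signPass
  have h := this c
  rw [← hc] at h
  exact ⟨c, h.eq_of_nil⟩

theorem final_iff_exists_signPass : Final n s Q ↔ ∃ j, (signPass n)^[j] s = ⟨[], Q⟩ :=
  ⟨Final.exists_signPass, fun ⟨j, hj⟩ => by
    have := later_signPass_iterate n s j
    rwa [hj] at this⟩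

theorem signState_passEnd (n : ℕ) (w : List ℤ) (j : ℕ) :
    signState n w (passEnd n w j) = (signPass n)^[j] ⟨w, []⟩ := by
  induction j with
  | zero => rfl
  | succ j ih =>
    rw [Function.iterate_succ_apply', signPass_eq_iterate, ← ih, passEnd, signState, add_comm,
      Function.iterate_add_apply]
    rfl

theorem length_recording {w : List ℤ} (h : Final n ⟨w, []⟩ Q) (c : ℕ) :
    (recording n w c).length = commonPrefix (signState n w c).col Q := by
  induction c with
  | zero => simp [recording, signState, commonPrefix]
  | succ c ih =>
    have hl : Later n (signState n w c) (signState n w (c + 1)) :=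
      later_iterate_of_le (Nat.le_succ c)
    -- Monotonicity makes the truncated subtraction in `recording` exact.
    have := commonPrefix_le_of_later hl (h.later ⟨c, rfl⟩)
    simp only [recording, List.length_append, List.length_replicate, ih, signP_eq_of_final h]
    omega

/-- The sign insertion algorithm stops from `s` with the column `Q`, of which at least
`η₁ + ⋯ + ηⱼ` entries are in place after `j` passes, for all `j`. -/
def Catabolizes (n : ℕ) (η : List ℕ) (s : SignState) (Q : List ℤ) : Prop :=
  Final n s Q ∧ ∀ j ≤ η.length, (η.take j).sum ≤ commonPrefix ((signPass n)^[j] s).col Q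

theorem catabolizes_iff {w : List ℤ} {η : List ℕ} (hw : Incongruent n w) :
    Catabolizes n η ⟨w, []⟩ Q ↔ signP n w = Q ∧ WordCatabolizable n η w := by
  have hf : Final n ⟨w, []⟩ Q ↔ signP n w = Q :=
    ⟨signP_eq_of_final, fun h => h ▸ final_signP hw⟩
  rw [Catabolizes, hf]
  refine and_congr_right fun h => ?_
  simp only [WordCatabolizable, length_recording (hf.2 h), signState_passEnd]
  refine ⟨fun h j _ hj => h j hj, fun h j hj => ?_⟩
  rcases Nat.eq_zero_or_pos j with rfl | hj'
  · simp
  · exact h j hj' hj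

theorem Catabolizes.congr {η : List ℕ} (h : Catabolizes n η s Q) (hf : Final n s' Q)
    (hs : ∀ j, ((signPass n)^[j] s').col = ((signPass n)^[j] s).col) : Catabolizes n η s' Q :=
  ⟨hf, fun j hj => by rw [hs]; exact h.2 j hj⟩

/-! ### Knuth equivalent words -/

/-- The two runs are compared at the ends of passes, where the columns coincide. -/
theorem signPass_iterate_knuthEquiv (hc : s'.col = s.col) (hw : KnuthEquiv s.word s'.word)
    (hs : Incongruent n s.letters) (hsort : s.col.Pairwise (· < ·)) (j : ℕ) :
    ((signPass n)^[j] s').col = ((signPass n)^[j] s).col ∧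
      KnuthEquiv ((signPass n)^[j] s).word ((signPass n)^[j] s').word := by
  induction j with
  | zero => exact ⟨hc, hw⟩
  | succ j ih =>
    have hl := later_signPass_iterate n s j
    rw [Function.iterate_succ_apply', Function.iterate_succ_apply', signPass, signPass, ih.1]
    have := KnuthEquiv.columnPass ih.2 (hl.sorted hsort) (hl.incongruent hs).nodup
    exact ⟨this.1.symm, KnuthEquiv.map_add this.2 _⟩

theorem Catabolizes.knuthEquiv {η : List ℕ} {w w' : List ℤ} (h : Catabolizes n η ⟨w, P⟩ Q)
    (hw : KnuthEquiv w w') (hs : Incongruent n (w ++ P)) (hsort : P.Pairwise (· < ·)) :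
    Catabolizes n η ⟨w', P⟩ Q := by
  have key := signPass_iterate_knuthEquiv (n := n) (s := ⟨w, P⟩) (s' := ⟨w', P⟩) rfl hw hs hsort
  refine h.congr ?_ fun j => (key j).1
  obtain ⟨j, hj⟩ := h.1.exists_signPass
  refine final_iff_exists_signPass.2 ⟨j, ?_⟩
  have := key j
  rw [hj] at this
  -- Knuth equivalent words are permutations of each other, so the second word is empty at the same
  -- time as the first.
  have hnil := (KnuthEquiv.perm this.2).symm.eq_nil
  rcases hs' : (signPass n)^[j] ⟨w', P⟩ with ⟨x, C⟩
  rw [hs'] at hnil this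
  simp_all

theorem catabolizes_knuthEquiv_iff {η : List ℕ} {w w' : List ℤ} (hw : KnuthEquiv w w')
    (hs : Incongruent n w) :
    Catabolizes n η ⟨w, []⟩ Q ↔ Catabolizes n η ⟨w', []⟩ Q :=
  ⟨fun h => h.knuthEquiv hw (by simpa using hs) .nil,
    fun h => h.knuthEquiv hw.symm (by simpa using hs.perm (KnuthEquiv.perm hw)) .nil⟩

/-! ### Translation -/

theorem insertIntoColumn_map_add (t a : ℤ) (P : List ℤ) :
    insertIntoColumn (t + a) (P.map (t + ·)) =
      ((insertIntoColumn a P).1.map (t + ·), (insertIntoColumn a P).2.map (t + ·)) := by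
  induction P with
  | nil => rfl
  | cons p P ih =>
    rcases le_or_gt a p with h | h
    · simp [insertIntoColumn, h]
    · simp [insertIntoColumn, not_le.2 h, ih]

theorem signStep_shift (t : ℤ) (s : SignState) :
    signStep n (s.shift t) = (signStep n s).shift t := by
  rcases eq_nil_or_concat s with ⟨P, rfl⟩ | ⟨x, a, P, rfl⟩
  · rfl
  · simp only [shift, List.map_append, List.map_cons, List.map_nil, signStep_concat,
      insertIntoColumn_map_add]
    cases (insertIntoColumn a P).2 <;> simp [add_left_comm]

theorem signStep_iterate_shift (t : ℤ) (s : SignState) (c : ℕ) :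
    (signStep n)^[c] (s.shift t) = ((signStep n)^[c] s).shift t :=
  Function.Semiconj.iterate_right (f := shift t) (fun s => (signStep_shift t s).symm) c s
    |>.symm

theorem signPass_iterate_shift (t : ℤ) (s : SignState) (j : ℕ) :
    (signPass n)^[j] (s.shift t) = ((signPass n)^[j] s).shift t := by
  refine (Function.Semiconj.iterate_right (f := shift t) (fun s => ?_) j s).symm
  rw [signPass_eq_iterate, signPass_eq_iterate, signStep_iterate_shift]
  simp [shift]

theorem commonPrefix_map_add (t : ℤ) :
    ∀ P Q : List ℤ, commonPrefix (P.map (t + ·)) (Q.map (t + ·)) = commonPrefix P Q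
  | [], _ => by simp [commonPrefix]
  | _ :: _, [] => by simp [commonPrefix]
  | p :: P, q :: Q => by simp [commonPrefix, commonPrefix_map_add t P Q]

theorem Final.shift (h : Final n s Q) (t : ℤ) : Final n (s.shift t) (Q.map (t + ·)) := by
  obtain ⟨c, hc⟩ := h
  exact ⟨c, by rw [signStep_iterate_shift, ← hc]; rfl⟩

theorem Catabolizes.shift {η : List ℕ} (h : Catabolizes n η s Q) (t : ℤ) :
    Catabolizes n η (s.shift t) (Q.map (t + ·)) := by
  refine ⟨h.1.shift t, fun j hj => (h.2 j hj).trans ?_⟩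
  rw [signPass_iterate_shift, SignState.shift, commonPrefix_map_add]

theorem catabolizes_map_add_iff {η : List ℕ} (t : ℤ) {w : List ℤ} :
    Catabolizes n η ⟨w.map (t + ·), []⟩ (Q.map (t + ·)) ↔ Catabolizes n η ⟨w, []⟩ Q := by
  refine ⟨fun h => ?_, fun h => h.shift t⟩
  have h := h.shift (-t)
  simpa [SignState.shift, Function.comp_def] using h

/-! ### Letters that stay on top of the column -/

theorem insertIntoColumn_append_of_forall_lt {a : ℤ} (P : List ℤ) (h : ∀ k ∈ K, k < a) :
    insertIntoColumn a (K ++ P) =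
      (K ++ (insertIntoColumn a P).1, (insertIntoColumn a P).2) := by
  induction K with
  | nil => rfl
  | cons k K ih =>
    simp only [List.forall_mem_cons] at h
    rw [List.cons_append, insertIntoColumn_cons_of_lt h.1, ih h.2]
    rfl

theorem signStep_addPrefix (h : ∀ k ∈ K, ∀ a ∈ s.letters, k < a) :
    signStep n (s.addPrefix K) = (signStep n s).addPrefix K := by
  rcases eq_nil_or_concat s with ⟨P, rfl⟩ | ⟨x, a, P, rfl⟩
  · rfl
  · simp only [addPrefix, signStep_concat]
    rw [insertIntoColumn_append_of_forall_lt]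
    exact fun k hk => h k hk a (by simp [letters])

theorem signStep_iterate_addPrefix (h : ∀ k ∈ K, ∀ a ∈ s.letters, k < a) (c : ℕ) :
    (signStep n)^[c] (s.addPrefix K) = ((signStep n)^[c] s).addPrefix K := by
  induction c with
  | zero => rfl
  | succ c ih =>
    rw [Function.iterate_succ_apply', ih, Function.iterate_succ_apply', signStep_addPrefix]
    exact Later.forall_lt ⟨c, rfl⟩ h

theorem signPass_iterate_addPrefix (h : ∀ k ∈ K, ∀ a ∈ s.letters, k < a) (j : ℕ) :
    (signPass n)^[j] (s.addPrefix K) = ((signPass n)^[j] s).addPrefix K := by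
  induction j with
  | zero => rfl
  | succ j ih =>
    rw [Function.iterate_succ_apply', ih, Function.iterate_succ_apply', signPass_eq_iterate,
      signStep_iterate_addPrefix ((later_signPass_iterate n s j).forall_lt h),
      signPass_eq_iterate]
    rfl

/-- Every letter present at some time is at least some letter present later, in particular some
entry of the final column. -/
theorem Final.forall_lt (h : Final n s Q) (hK : ∀ k ∈ K, ∀ q ∈ Q, k < q) :
    ∀ k ∈ K, ∀ a ∈ s.letters, k < a := fun k hk a ha => by
  obtain ⟨q, hq, hqa⟩ := Later.exists_ge h ha
  exact (hK k hk q (by simpa [letters] using hq)).trans_le hqa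

theorem Final.addPrefix (h : Final n s Q) (hK : ∀ k ∈ K, ∀ q ∈ Q, k < q) :
    Final n (s.addPrefix K) (K ++ Q) := by
  have h' := h.forall_lt hK
  obtain ⟨c, hc⟩ := h
  exact ⟨c, by rw [signStep_iterate_addPrefix h', ← hc]; rfl⟩

theorem Catabolizes.le_commonPrefix {η : List ℕ} (h : Catabolizes n η s Q)
    (hK : ∀ k ∈ K, ∀ q ∈ Q, k < q) {j : ℕ} (hj : j ≤ η.length) :
    K.length + (η.take j).sum ≤
      commonPrefix ((signPass n)^[j] (s.addPrefix K)).col (K ++ Q) := by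
  rw [signPass_iterate_addPrefix (h.1.forall_lt hK), SignState.addPrefix, commonPrefix_append]
  exact Nat.add_le_add_left (h.2 j hj) _

/-- If `a` replaced an entry of `K`, the column would drop strictly below a value it must still have
at the end. -/
theorem forall_lt_of_below_insertIntoColumn {a : ℤ}
    (h : Below (K ++ Q) (insertIntoColumn a (K ++ P)).1) (ha : a ∉ K) : ∀ k ∈ K, k < a := by
  induction K with
  | nil => simp
  | cons k K ih =>
    rw [List.mem_cons, not_or] at ha
    simp only [List.cons_append] at h
    rcases le_or_gt a k with hk | hk
    · rw [insertIntoColumn_cons_of_le hk] at h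
      exact absurd (le_antisymm hk h.1) ha.1
    · rw [insertIntoColumn_cons_of_lt hk] at h
      exact List.forall_mem_cons.2 ⟨hk, ih h.2 ha.2⟩

/-- Since entries never rise again, no inserted letter can touch `K`. Induction on the remaining
steps shows that each letter exceeds `K`, so `K` may be removed from the whole run. -/
theorem Final.of_addPrefix (h : Final n (s.addPrefix K) (K ++ Q))
    (hs : Incongruent n (s.addPrefix K).letters)
    (hsort : (s.addPrefix K).col.Pairwise (· < ·)) :
    (∀ k ∈ K, ∀ a ∈ s.letters, k < a) ∧ Final n s Q := by
  obtain ⟨c, hc⟩ := id h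
  induction c generalizing s with
  | zero =>
    obtain ⟨x, P⟩ := s
    simp only [Function.iterate_zero, id_eq, SignState.addPrefix, SignState.mk.injEq,
      List.append_cancel_left_eq] at hc
    obtain ⟨rfl, rfl⟩ := hc
    exact ⟨fun k hk q hq => (List.pairwise_append.1 hsort).2.2 k hk q
      (by simpa [letters] using hq), .refl _⟩
  | succ c ih =>
    have hKs : ∀ k ∈ K, ∀ a ∈ s.col, k < a := (List.pairwise_append.1 hsort).2.2
    rcases eq_nil_or_concat s with ⟨P, rfl⟩ | ⟨x, a, P, rfl⟩
    · have h' := h.eq_of_nil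
      simp only [SignState.mk.injEq, List.append_cancel_left_eq, true_and] at h'
      subst h'
      exact ⟨fun k hk q hq => hKs k hk q (by simpa [letters] using hq), .refl _⟩
    · have hstep := later_signStep n (SignState.addPrefix K ⟨x ++ [a], P⟩)
      have h' := h.later hstep
      have hKa : ∀ k ∈ K, k < a := by
        have hb := Later.below h'
        simp only [SignState.addPrefix, signStep_concat] at hb
        refine forall_lt_of_below_insertIntoColumn hb fun ha => ?_
        have := hs.nodup
        simp [letters, SignState.addPrefix, List.nodup_append, ha] at this
      have heq : signStep n (SignState.addPrefix K ⟨x ++ [a], P⟩) =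
          (signStep n ⟨x ++ [a], P⟩).addPrefix K := by
        simp only [SignState.addPrefix, signStep_concat,
          insertIntoColumn_append_of_forall_lt P hKa]
      rw [heq] at hstep h'
      rw [Function.iterate_succ_apply, heq] at hc
      obtain ⟨h1, h2⟩ := ih h' (hstep.incongruent hs) (hstep.sorted hsort) hc
      refine ⟨fun k hk b hb => ?_, (later_signStep n _).trans h2⟩
      simp only [letters, List.mem_append, List.mem_singleton] at hb
      rcases hb with (hb | rfl) | hb
      · exact h1 k hk b (by simp [letters, signStep_concat, hb])
      · exact hKa k hk
      · exact hKs k hk b hb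

/-- Going back from a state in the first pass in which the letters of `K` are in place. -/
theorem Catabolizes.of_later {η : List ℕ} (hK : ∀ k ∈ K, ∀ q ∈ Q, k < q)
    (hs : Later n s (s'.addPrefix K)) (hs' : Later n (s'.addPrefix K) (signPass n s))
    (h : Catabolizes n η s' Q) : Catabolizes n (K.length :: η) s (K ++ Q) := by
  have hf := h.1.addPrefix hK
  refine ⟨hs.trans hf, fun j hj => ?_⟩
  cases j with
  | zero => simp
  | succ j =>
    rw [Function.iterate_succ_apply, List.take_succ_cons, List.sum_cons]
    -- By `hs'` the first pass ends at or after `s'.addPrefix K`; hence `j` further passes from its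
    -- end get at least as far as `j` passes from that state.
    exact (h.le_commonPrefix hK (Nat.le_of_succ_le_succ hj)).trans
      (commonPrefix_le_of_later (hs'.signPass_iterate j)
        (hf.later (later_signPass_iterate n _ j)))

/-- The condition for `j = 1` puts `k` entries in place after one pass. They are inert by
`Final.of_addPrefix`, so `k` cancels from all later conditions. -/
theorem Catabolizes.exists_signPass {η : List ℕ} {k : ℕ} (h : Catabolizes n (k :: η) s Q)
    (hs : Incongruent n s.letters) (hsort : s.col.Pairwise (· < ·)) :
    ∃ K P Q', K.length = k ∧ Q = K ++ Q' ∧ (signPass n s).col = K ++ P ∧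
      Catabolizes n η ⟨(signPass n s).word, P⟩ Q' := by
  have h1 := h.2 1 (by simp)
  simp only [List.take_succ_cons, List.take_zero, List.sum_cons, List.sum_nil, add_zero,
    Function.iterate_one] at h1
  obtain ⟨K, P, Q', hK, hP, rfl⟩ := exists_append_of_le_commonPrefix h1
  have hl := later_signPass n s
  have he : signPass n s = SignState.addPrefix K ⟨(signPass n s).word, P⟩ := by
    rw [SignState.addPrefix, ← hP]
  have hf := h.1.later hl
  rw [he] at hl hf
  obtain ⟨hlt, hf'⟩ := hf.of_addPrefix (hl.incongruent hs) (hl.sorted hsort)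
  refine ⟨K, P, Q', hK, rfl, hP, hf', fun j hj => ?_⟩
  have hj' := h.2 (j + 1) (Nat.succ_le_succ hj)
  rw [Function.iterate_succ_apply, he, signPass_iterate_addPrefix hlt, SignState.addPrefix,
    commonPrefix_append, List.take_succ_cons, List.sum_cons, hK] at hj'
  omega

theorem columnPass_reverse {K : List ℤ} (hP : (K ++ P).Pairwise (· < ·)) :
    columnPass P.reverse K = (K ++ P, []) := by
  induction P using List.reverseRecOn generalizing K with
  | nil => simp [columnPass]
  | append_singleton P p ih =>
    rw [List.reverse_append, List.reverse_singleton, List.singleton_append, columnPass,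
      ih (hP.sublist ((List.sublist_append_left _ _).append_left _))]
    rw [← List.append_assoc, List.pairwise_append] at hP
    have := insertIntoColumn_append_of_forall_lt (a := p) (K := K ++ P) []
      fun k hk => hP.2.2 k hk p (by simp)
    simp only [List.append_nil, insertIntoColumn_nil] at this
    simp [this]

/-- Inserting the reading word of a column first amounts to starting with that column. -/
theorem catabolizes_append_reverse_iff {η : List ℕ} {x : List ℤ}
    (hP : P.Pairwise (· < ·)) :
    Catabolizes n η ⟨x ++ P.reverse, []⟩ Q ↔ Catabolizes n η ⟨x, P⟩ Q := by
  have he : signPass n ⟨x ++ P.reverse, []⟩ = signPass n ⟨x, P⟩ := by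
    simp only [signPass, columnPass_append]
    rw [columnPass_reverse (K := []) (by simpa using hP)]
    simp
  rw [Catabolizes, Catabolizes, final_iff_of_later (later_signPass n _), he,
    ← final_iff_of_later (later_signPass n _)]
  refine and_congr_right fun _ => forall₂_congr fun j _ => ?_
  -- The two runs coincide from the end of the first pass on, and `j = 0` imposes no condition.
  cases j with
  | zero => simp
  | succ j => rw [Function.iterate_succ_apply, he, Function.iterate_succ_apply]

end

/-! ### Tableaux -/

/-- The row `r` may stand directly above the row `s` in a tableau. -/
def Dominates : List ℤ → List ℤ → Prop
  | _, [] => True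
  | [], _ :: _ => False
  | a :: r, b :: s => a < b ∧ Dominates r s

theorem dominates_iff : ∀ {r s : List ℤ}, Dominates r s ↔ s.length ≤ r.length ∧
    ∀ (j : ℕ) (hr : j < r.length) (hs : j < s.length), r[j] < s[j]
  | _, [] => by simp [Dominates]
  | [], _ :: _ => by simp [Dominates]
  | a :: r, b :: s => by
    rw [Dominates, dominates_iff (r := r)]
    refine ⟨fun ⟨h, h1, h2⟩ => ⟨Nat.succ_le_succ h1, fun j hr hs => ?_⟩,
      fun ⟨h1, h2⟩ => ⟨h2 0 (by simp) (by simp), Nat.le_of_succ_le_succ h1, fun j hr hs => ?_⟩⟩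
    · cases j with
      | zero => exact h
      | succ j => exact h2 j (Nat.lt_of_succ_lt_succ hr) (Nat.lt_of_succ_lt_succ hs)
    · exact h2 (j + 1) (Nat.succ_lt_succ hr) (Nat.succ_lt_succ hs)

theorem Dominates.trans : ∀ {r s t : List ℤ}, Dominates r s → Dominates s t → Dominates r t
  | _, _, [], _, _ => by simp [Dominates]
  | [], [], _ :: _, _, h => h
  | [], _ :: _, _ :: _, h, _ => h.elim
  | _ :: _, [], _ :: _, _, h => h.elim
  | _ :: _, _ :: _, _ :: _, h, h' => ⟨h.1.trans h'.1, h.2.trans h'.2⟩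

theorem Dominates.drop_one : ∀ {r s : List ℤ}, Dominates r s → Dominates (r.drop 1) (s.drop 1)
  | _, [], _ => by simp [Dominates]
  | [], _ :: _, h => h.elim
  | _ :: _, _ :: _, h => h.2

theorem isTableau_iff {T : Filling} : IsTableau T ↔
    (∀ r ∈ T, r ≠ []) ∧ (∀ r ∈ T, r.Pairwise (· ≤ ·)) ∧ T.Pairwise Dominates := by
  simp only [IsTableau, shape, List.pairwise_map]
  have : T.Pairwise Dominates ↔ T.Pairwise (fun r s => r.length ≥ s.length) ∧
      T.Pairwise (fun r s => ∀ (j : ℕ) (hr : j < r.length) (hs : j < s.length), r[j] < s[j]) := by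
    rw [← List.pairwise_and_iff]
    exact ⟨fun h => h.imp dominates_iff.1, fun h => h.imp dominates_iff.2⟩
  rw [this]
  tauto

theorem isTableau_nil : IsTableau [] := by simp [isTableau_iff]

theorem isTableau_cons_iff {r : List ℤ} {T : Filling} : IsTableau (r :: T) ↔
    r ≠ [] ∧ r.Pairwise (· ≤ ·) ∧ (∀ s ∈ T, Dominates r s) ∧ IsTableau T := by
  simp only [isTableau_iff, List.forall_mem_cons, List.pairwise_cons]
  tauto

theorem isTableau_cons_cons_iff {r s : List ℤ} {T : Filling} : IsTableau (r :: s :: T) ↔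
    r ≠ [] ∧ r.Pairwise (· ≤ ·) ∧ Dominates r s ∧ IsTableau (s :: T) := by
  rw [isTableau_cons_iff]
  refine and_congr_right fun _ => and_congr_right fun _ => ?_
  constructor
  · exact fun h => ⟨h.1 s (by simp), h.2⟩
  · refine fun h => ⟨List.forall_mem_cons.2 ⟨h.1, fun t ht => h.1.trans ?_⟩, h.2⟩
    exact (isTableau_cons_iff.1 h.2).2.2.1 t ht

/-! ### Row insertion -/

section

variable {a b : ℤ} {r s : List ℤ}

theorem insertIntoRow_cons_of_lt (h : a < b) : insertIntoRow a (b :: r) = (a :: r, some b) := by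
  simp [insertIntoRow, h]

theorem insertIntoRow_cons_of_le (h : b ≤ a) :
    insertIntoRow a (b :: r) = (b :: (insertIntoRow a r).1, (insertIntoRow a r).2) := by
  simp [insertIntoRow, not_lt.2 h]

theorem insertIntoRow_ne_nil (a : ℤ) (r : List ℤ) : (insertIntoRow a r).1 ≠ [] := by
  cases r with
  | nil => simp [insertIntoRow]
  | cons b r =>
    rcases lt_or_ge a b with h | h
    · simp [insertIntoRow_cons_of_lt h]
    · simp [insertIntoRow_cons_of_le h]

theorem insertIntoRow_bumped (h : (insertIntoRow a r).2 = some b) : a < b := by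
  induction r with
  | nil => simp [insertIntoRow] at h
  | cons c r ih =>
    rcases lt_or_ge a c with hc | hc
    · rw [insertIntoRow_cons_of_lt hc] at h
      obtain rfl : c = b := by simpa using h
      exact hc
    · rw [insertIntoRow_cons_of_le hc] at h
      exact ih h

theorem mem_cons_of_mem_insertIntoRow (h : b ∈ (insertIntoRow a r).1) : b ∈ a :: r := by
  induction r with
  | nil => simpa [insertIntoRow] using h
  | cons c r ih =>
    rcases lt_or_ge a c with hc | hc
    · rw [insertIntoRow_cons_of_lt hc] at h
      simp only [List.mem_cons] at h ⊢
      tauto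
    · rw [insertIntoRow_cons_of_le hc] at h
      simp only [List.mem_cons] at h ih ⊢
      tauto

theorem insertIntoRow_sorted (hr : r.Pairwise (· ≤ ·)) :
    (insertIntoRow a r).1.Pairwise (· ≤ ·) := by
  induction r with
  | nil => simp [insertIntoRow]
  | cons c r ih =>
    rw [List.pairwise_cons] at hr
    rcases lt_or_ge a c with hc | hc
    · rw [insertIntoRow_cons_of_lt hc]
      exact List.pairwise_cons.2 ⟨fun x hx => hc.le.trans (hr.1 x hx), hr.2⟩
    · rw [insertIntoRow_cons_of_le hc]
      refine List.pairwise_cons.2 ⟨fun x hx => ?_, ih hr.2⟩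
      rcases List.mem_cons.1 (mem_cons_of_mem_insertIntoRow hx) with rfl | hx
      · exact hc
      · exact hr.1 x hx

theorem Dominates.insertIntoRow_left (h : Dominates r s) :
    Dominates (insertIntoRow a r).1 s := by
  induction r generalizing s with
  | nil => cases s with
    | nil => simp [Dominates]
    | cons => exact h.elim
  | cons c r ih => cases s with
    | nil => simp [Dominates]
    | cons d s =>
      rcases lt_or_ge a c with hc | hc
      · rw [insertIntoRow_cons_of_lt hc]
        exact ⟨hc.trans h.1, h.2⟩
      · rw [insertIntoRow_cons_of_le hc]
        exact ⟨h.1, ih h.2⟩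

/-- Below its old place `b` meets a larger entry or none, so it lands weakly further west, under an
entry that is at most `a` and hence less than `b`. -/
theorem Dominates.insertIntoRow (h : Dominates r s) (hb : (insertIntoRow a r).2 = some b) :
    Dominates (insertIntoRow a r).1 (AffineTableaux.insertIntoRow b s).1 := by
  induction r generalizing s with
  | nil => simp [AffineTableaux.insertIntoRow] at hb
  | cons c r ih =>
    rcases lt_or_ge a c with hc | hc
    · rw [insertIntoRow_cons_of_lt hc] at hb ⊢
      obtain rfl : c = b := by simpa using hb
      cases s with
      | nil => exact ⟨hc, by simp [Dominates]⟩
      | cons d s =>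
        rw [insertIntoRow_cons_of_lt h.1]
        exact ⟨hc, h.2⟩
    · rw [insertIntoRow_cons_of_le hc] at hb ⊢
      have hab := insertIntoRow_bumped hb
      cases s with
      | nil => exact ⟨hc.trans_lt hab, by simp [Dominates]⟩
      | cons d s =>
        rcases lt_or_ge b d with hd | hd
        · rw [insertIntoRow_cons_of_lt hd]
          exact ⟨hc.trans_lt hab, h.2.insertIntoRow_left⟩
        · rw [insertIntoRow_cons_of_le hd]
          exact ⟨h.1, ih h.2 hb⟩

end

theorem rowInsert_cons (a : ℤ) (r : List ℤ) (T : Filling) : rowInsert a (r :: T) =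
    (insertIntoRow a r).1 :: ((insertIntoRow a r).2.elim T fun b => rowInsert b T) := by
  rw [rowInsert]
  rcases insertIntoRow a r with ⟨r', _ | b⟩ <;> rfl

theorem isTableau_rowInsert {T : Filling} (hT : IsTableau T) (a : ℤ) :
    IsTableau (rowInsert a T) := by
  induction T generalizing a with
  | nil => simp [rowInsert, isTableau_iff]
  | cons r T ih =>
    have h := isTableau_cons_iff.1 hT
    rw [rowInsert_cons]
    have h1 := insertIntoRow_ne_nil a r
    have h2 := insertIntoRow_sorted (a := a) h.2.1
    cases hb : (insertIntoRow a r).2 with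
    | none =>
      exact isTableau_cons_iff.2 ⟨h1, h2, fun s hs => (h.2.2.1 s hs).insertIntoRow_left, h.2.2.2⟩
    | some b =>
      have := ih h.2.2.2 b
      rw [Option.elim_some]
      cases T with
      | nil => exact isTableau_cons_cons_iff.2 ⟨h1, h2,
          Dominates.insertIntoRow (s := []) (by simp [Dominates]) hb, this⟩
      | cons s T =>
        rw [rowInsert_cons] at this ⊢
        exact isTableau_cons_cons_iff.2 ⟨h1, h2, (h.2.2.1 s (by simp)).insertIntoRow hb, this⟩

theorem isTableau_insertionTableau (w : List ℤ) : IsTableau (insertionTableau w) := by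
  rw [insertionTableau]
  suffices ∀ T, IsTableau T → IsTableau (w.foldl (fun T a => rowInsert a T) T) from
    this [] isTableau_nil
  induction w with
  | nil => exact fun T hT => hT
  | cons a w ih => exact fun T hT => ih _ (isTableau_rowInsert hT a)

/-! ### Row reading words -/

theorem rowWord_cons (r : List ℤ) (T : Filling) : rowWord (r :: T) = rowWord T ++ r := by
  simp [rowWord]

theorem rowWord_append (S T : Filling) : rowWord (S ++ T) = rowWord T ++ rowWord S := by
  simp [rowWord]

theorem rowWord_translate (t : ℤ) (T : Filling) :
    rowWord (translate t T) = (rowWord T).map (t + ·) := by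
  simp [rowWord, translate, List.map_flatten]

theorem eq_nil_of_rowWord_eq_nil {T : Filling} (hT : IsTableau T) (h : rowWord T = []) :
    T = [] := by
  cases T with
  | nil => rfl
  | cons r T =>
    rw [rowWord_cons, List.append_eq_nil_iff] at h
    exact absurd h.2 (hT.1 r (by simp))

theorem rowWord_columnTableau (P : List ℤ) : rowWord (columnTableau P) = P.reverse := by
  induction P with
  | nil => rfl
  | cons p P ih =>
    rw [columnTableau, List.map_cons, rowWord_cons, List.reverse_cons, ← ih]
    rfl

theorem knuthEquiv_insertIntoRow {a : ℤ} {r : List ℤ} (hr : r.Pairwise (· ≤ ·))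
    (hn : (r ++ [a]).Nodup) :
    KnuthEquiv (r ++ [a]) ((insertIntoRow a r).2.toList ++ (insertIntoRow a r).1) := by
  induction r with
  | nil => exact .refl
  | cons c r ih =>
    rw [List.cons_append, List.nodup_cons] at hn
    rw [List.pairwise_cons] at hr
    have hlt : ∀ x ∈ r, c < x := fun x hx =>
      lt_of_le_of_ne (hr.1 x hx) fun e => hn.1 (by simp [e, hx])
    rcases lt_or_ge a c with h | h
    · rw [insertIntoRow_cons_of_lt h]
      simp only [Option.toList_some, List.singleton_append]
      -- The letter `a` is below the whole row and moves left past all letters but the first by `bca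
      -- ~ bac`, its left neighbours playing `c` and `b`.
      suffices H : ∀ (S : List ℤ) (x : ℤ), a < x → (x :: S).Pairwise (· < ·) →
          KnuthEquiv (x :: S ++ [a]) (x :: a :: S) from
        H r c h (List.pairwise_cons.2 ⟨hlt, (hr.2.and (List.nodup_append.1 hn.2).1).imp
          fun h => lt_of_le_of_ne h.1 h.2⟩)
      intro S
      induction S with
      | nil => intro x _ _; exact .refl
      | cons y S ih =>
        intro x hx hS
        have hxy := (List.pairwise_cons.1 hS).1 y (by simp)
        have h1 := (ih y (hx.trans hxy) (List.pairwise_cons.1 hS).2).append_left [x]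
        exact h1.trans (KnuthEquiv.bac_bca hx hxy [] S).symm
    · rw [insertIntoRow_cons_of_le h]
      have h1 := (ih hr.2 hn.2).append_left [c]
      refine Relation.ReflTransGen.trans h1 ?_
      cases hb : (insertIntoRow a r).2 with
      | none => exact .refl
      | some b =>
        have hab := insertIntoRow_bumped hb
        have hca : c < a := lt_of_le_of_ne h fun e => hn.1 (by simp [e])
        -- To carry the bumped `b` to the left of `c`, the head `f` of the new row is used: `c < f ≤
        -- a < b`, so `acb ~ cab` applies.
        cases hI : (insertIntoRow a r).1 with
        | nil => exact absurd hI (insertIntoRow_ne_nil a r)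
        | cons f F =>
          have hf : f ∈ a :: r := mem_cons_of_mem_insertIntoRow (by simp [hI])
          have hcf : c < f := by
            rcases List.mem_cons.1 hf with rfl | hf
            · exact hca
            · exact hlt f hf
          have hfa : f ≤ a := by
            cases r with
            | nil => simp [insertIntoRow] at hb
            | cons d r =>
              rcases lt_or_ge a d with hd | hd
              · rw [insertIntoRow_cons_of_lt hd] at hI
                exact (List.cons.inj hI).1.symm.le
              · rw [insertIntoRow_cons_of_le hd] at hI
                exact (List.cons.inj hI).1 ▸ hd
          exact KnuthEquiv.acb_cab hcf (hfa.trans_lt hab) [] F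

theorem knuthEquiv_rowInsert {T : Filling} (hT : ∀ r ∈ T, r.Pairwise (· ≤ ·)) {a : ℤ}
    (hn : (rowWord T ++ [a]).Nodup) :
    KnuthEquiv (rowWord T ++ [a]) (rowWord (rowInsert a T)) := by
  induction T generalizing a with
  | nil => exact .refl
  | cons r T ih =>
    rw [List.forall_mem_cons] at hT
    rw [rowWord_cons, List.append_assoc] at hn
    rw [rowInsert_cons, rowWord_cons, rowWord_cons, List.append_assoc]
    have hra := List.nodup_append.1 hn
    have h1 := knuthEquiv_insertIntoRow hT.1 hra.2.1
    refine Relation.ReflTransGen.trans (h1.append_left _) ?_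
    have hp := KnuthEquiv.perm h1
    cases hb : (insertIntoRow a r).2 with
    | none => exact .refl
    | some b =>
      rw [hb] at hp
      have hn' := ((hp.append_left (rowWord T)).nodup_iff).1 hn
      rw [← List.append_assoc] at hn'
      have := (ih hT.2 (List.nodup_append.1 hn').1).append_right (insertIntoRow a r).1
      simpa using this

theorem knuthEquiv_insertionTableau {w : List ℤ} (hw : w.Nodup) :
    KnuthEquiv w (rowWord (insertionTableau w)) := by
  induction w using List.reverseRecOn with
  | nil => exact .refl
  | append_singleton w a ih =>
    have h := ih (List.nodup_append.1 hw).1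
    have hr : insertionTableau (w ++ [a]) = rowInsert a (insertionTableau w) := by
      simp [insertionTableau]
    have hw' := ((KnuthEquiv.perm h).append_right [a]).nodup_iff.1 hw
    rw [hr]
    exact (h.append_right [a]).trans
      (knuthEquiv_rowInsert (isTableau_iff.1 (isTableau_insertionTableau w)).2.1 hw')

/-! ### Columns -/

/-- The westernmost column. -/
def firstColumn (T : Filling) : List ℤ := T.filterMap fun r => r[0]?

/-- The tableau formed by all columns but the first. -/
def tailColumns (T : Filling) : Filling := (east 1 T).filter fun r => !r.isEmpty

theorem rowWord_tailColumns (T : Filling) : rowWord (tailColumns T) = rowWord (east 1 T) := by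
  rw [rowWord, tailColumns, ← List.filter_reverse, List.flatten_filter_not_isEmpty]
  rfl

theorem isTableau_tailColumns {T : Filling} (hT : IsTableau T) : IsTableau (tailColumns T) := by
  rw [isTableau_iff] at hT ⊢
  refine ⟨fun r hr => ?_, fun r hr => ?_, ?_⟩
  · simpa using (List.mem_filter.1 hr).2
  · obtain ⟨s, hs, rfl⟩ := List.mem_map.1 (List.mem_filter.1 hr).1
    exact (hT.2.1 s hs).sublist (List.drop_sublist _ _)
  · refine List.Pairwise.filter _ ?_
    rw [east, List.pairwise_map]
    exact hT.2.2.imp fun h => h.drop_one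

theorem firstColumn_cons_cons (a : ℤ) (r : List ℤ) (T : Filling) :
    firstColumn ((a :: r) :: T) = a :: firstColumn T := rfl

theorem columns_eq_cons {T : Filling} (hT : IsTableau T) (hne : T ≠ []) :
    columns T = firstColumn T :: columns (tailColumns T) := by
  have hf : ∀ j, (T.filterMap fun r => r[j + 1]?) = (tailColumns T).filterMap fun r => r[j]? := by
    intro j
    rw [tailColumns, east, List.filterMap_filter, List.filterMap_map]
    refine List.filterMap_congr fun r _ => ?_
    rcases r with _ | ⟨a, _ | ⟨b, r⟩⟩ <;> simp
  have hl : (T.headD []).length = ((tailColumns T).headD []).length + 1 := by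
    rcases T with _ | ⟨_ | ⟨a, _ | ⟨b, r⟩⟩, T⟩
    · exact absurd rfl hne
    · exact absurd rfl (hT.1 [] (by simp))
    · have : tailColumns ([a] :: T) = [] := by
        refine List.filter_eq_nil_iff.2 fun s hs => ?_
        obtain ⟨t, ht, rfl⟩ := List.mem_map.1 hs
        rcases List.mem_cons.1 ht with rfl | ht
        · simp
        · have := (dominates_iff.1 ((isTableau_cons_iff.1 hT).2.2.1 t ht)).1
          rw [List.drop_eq_nil_of_le (by simpa using this)]
          simp
      simp [this]
    · simp [tailColumns, east]
  rw [columns, hl, List.range_succ_eq_map, List.map_cons, List.map_map, columns]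
  refine congrArg₂ _ rfl (List.map_congr_left fun j _ => ?_)
  exact hf j

/-- Induction on the number of columns, matching the recursion of column catabolizability with all
parts equal to `1`. -/
theorem isTableau_induction {p : Filling → Prop} (nil : p [])
    (cons : ∀ T, IsTableau T → T ≠ [] → p (tailColumns T) → p T) {T : Filling}
    (hT : IsTableau T) : p T := by
  obtain ⟨m, hm⟩ : ∃ m, (columns T).length = m := ⟨_, rfl⟩
  induction m generalizing T with
  | zero =>
    rcases eq_or_ne T [] with rfl | hne
    · exact nil
    · simp [columns_eq_cons hT hne] at hm
  | succ m ih =>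
    rcases eq_or_ne T [] with rfl | hne
    · exact nil
    · exact cons T hT hne (ih (isTableau_tailColumns hT)
        (by simpa [columns_eq_cons hT hne] using hm))

theorem colWord_eq {T : Filling} (hT : IsTableau T) (hne : T ≠ []) :
    colWord T = (firstColumn T).reverse ++ colWord (tailColumns T) := by
  simp [colWord, columns_eq_cons hT hne]

theorem conjShape_eq {T : Filling} (hT : IsTableau T) (hne : T ≠ []) :
    conjShape T = (firstColumn T).length :: conjShape (tailColumns T) := by
  simp [conjShape, columns_eq_cons hT hne]

theorem stack_eq (n : ℕ) {T : Filling} (hT : IsTableau T) (hne : T ≠ []) :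
    stack n T = firstColumn T ++ (stack n (tailColumns T)).map ((n : ℤ) + ·) := by
  rw [stack, columns_eq_cons hT hne, List.mapIdx_cons, List.flatten_cons, stack,
    List.map_flatten]
  congr 1
  · simp
  · congr 1
    refine List.ext_getElem (by simp) fun i _ _ => ?_
    simp only [List.getElem_mapIdx, List.getElem_map, List.map_map]
    refine List.map_congr_left fun x _ => ?_
    simp only [Function.comp_apply]
    push_cast
    ring

theorem le_of_mem_rowWord {a : ℤ} {r : List ℤ} {T : Filling} (hT : IsTableau ((a :: r) :: T)) :
    ∀ x ∈ rowWord T, a < x := by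
  intro x hx
  have h := isTableau_cons_iff.1 hT
  simp only [rowWord, List.mem_flatten, List.mem_reverse] at hx
  obtain ⟨s, hs, hx⟩ := hx
  have hd := h.2.2.1 s hs
  have hs' := (isTableau_iff.1 h.2.2.2).2.1 s hs
  cases s with
  | nil => simp at hx
  | cons b s =>
    rcases List.mem_cons.1 hx with rfl | hx
    · exact hd.1
    · exact hd.1.trans_le ((List.pairwise_cons.1 hs').1 x hx)

theorem columnPass_row {a : ℤ} {r : List ℤ} (h : (a :: r).Pairwise (· ≤ ·)) :
    columnPass (a :: r) [] = ([a], r) := by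
  induction r generalizing a with
  | nil => simp [columnPass, insertIntoColumn_nil]
  | cons b r ih =>
    rw [List.pairwise_cons] at h
    rw [columnPass, ih h.2, insertIntoColumn_cons_of_le (h.1 b (by simp))]
    rfl

theorem columnPass_append_of_forall_lt {K x : List ℤ} (P : List ℤ)
    (h : ∀ k ∈ K, ∀ a ∈ x, k < a) :
    columnPass x (K ++ P) = (K ++ (columnPass x P).1, (columnPass x P).2) := by
  induction K with
  | nil => rfl
  | cons k K ih =>
    rw [List.forall_mem_cons] at h
    rw [List.cons_append, columnPass_cons_of_forall_lt _ h.1, ih h.2]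
    rfl

/-- The top row is inserted first. Each row leaves its first letter and bumps the others in order;
the letters of the rows beneath exceed the first letters collected in `P`, so they act further south
only. -/
theorem columnPass_rowWord_append {T : Filling} (hT : IsTableau T) {P : List ℤ}
    (hP : ∀ p ∈ P, ∀ x ∈ rowWord T, p < x) :
    columnPass (rowWord T) P = (P ++ firstColumn T, rowWord (east 1 T)) := by
  induction T generalizing P with
  | nil => simp [rowWord, columnPass, firstColumn, east]
  | cons r T ih =>
    have h := isTableau_cons_iff.1 hT
    rcases r with _ | ⟨a, r⟩
    · exact absurd rfl h.1
    rw [rowWord_cons] at hP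
    have h1 : columnPass (a :: r) P = (P ++ [a], r) := by
      have := columnPass_append_of_forall_lt (x := a :: r) []
        fun p hp x hx => hP p hp x (List.mem_append_right _ hx)
      rwa [List.append_nil, columnPass_row h.2.1] at this
    rw [rowWord_cons, columnPass_append, h1, ih h.2.2.2]
    · simp [firstColumn_cons_cons, east, rowWord_cons]
    · intro p hp x hx
      rcases List.mem_append.1 hp with hp | hp
      · exact hP p hp x (List.mem_append_left _ hx)
      · rw [List.mem_singleton.1 hp]
        exact le_of_mem_rowWord hT x hx

theorem columnPass_rowWord {T : Filling} (hT : IsTableau T) :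
    columnPass (rowWord T) [] = (firstColumn T, rowWord (east 1 T)) :=
  columnPass_rowWord_append hT (by simp)

theorem firstColumn_sorted {T : Filling} (hT : IsTableau T) :
    (firstColumn T).Pairwise (· < ·) := by
  have := columnPass_sorted (rowWord T) (P := []) .nil
  rwa [columnPass_rowWord hT] at this

theorem rowWord_perm {T : Filling} (hT : IsTableau T) :
    (rowWord (east 1 T) ++ firstColumn T).Perm (rowWord T) := by
  have := columnPass_perm (rowWord T) []
  rwa [columnPass_rowWord hT, List.append_nil] at this

theorem knuthEquiv_rowWord {T : Filling} (hT : IsTableau T) (hn : (rowWord T).Nodup) :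
    KnuthEquiv (rowWord T) ((firstColumn T).reverse ++ rowWord (east 1 T)) := by
  have := knuthEquiv_columnPass (x := rowWord T) (P := []) .nil (by simpa using hn)
  rwa [columnPass_rowWord hT, List.reverse_nil, List.append_nil] at this

theorem knuthEquiv_rowWord_colWord {T : Filling} (hT : IsTableau T) (hn : (rowWord T).Nodup) :
    KnuthEquiv (rowWord T) (colWord T) := by
  refine isTableau_induction (p := fun T => (rowWord T).Nodup → KnuthEquiv (rowWord T) (colWord T))
    (fun _ => .refl) (fun T hT hne ih hn => ?_) hT hn
  rw [colWord_eq hT hne]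
  rw [rowWord_tailColumns] at ih
  exact (knuthEquiv_rowWord hT hn).trans
    ((ih (List.nodup_append.1 ((rowWord_perm hT).nodup_iff.2 hn)).1).append_left _)

/-! ### Catabolisms of a tableau with respect to a column -/

theorem columnTableau_injective : Function.Injective columnTableau :=
  List.map_injective_iff.2 fun _ _ h => by simpa using h

theorem shape_columnTableau (P : List ℤ) :
    shape (columnTableau P) = List.replicate P.length 1 := by
  simp [shape, columnTableau, Function.comp_def]

theorem map_take_one {T : Filling} (hT : ∀ r ∈ T, r ≠ []) :
    (T.map fun r => r.take 1) = columnTableau (firstColumn T) := by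
  induction T with
  | nil => rfl
  | cons r T ih =>
    rw [List.forall_mem_cons] at hT
    rcases r with _ | ⟨a, r⟩
    · exact absurd rfl hT.1
    · rw [List.map_cons, ih hT.2]
      rfl

theorem length_firstColumn {T : Filling} (hT : ∀ r ∈ T, r ≠ []) :
    (firstColumn T).length = T.length := by
  have := congrArg List.length (map_take_one hT)
  simpa [columnTableau] using this.symm

theorem firstColumn_take {T : Filling} (hT : ∀ r ∈ T, r ≠ []) (k : ℕ) :
    firstColumn (T.take k) = (firstColumn T).take k := by
  refine columnTableau_injective ?_
  rw [← map_take_one fun r hr => hT r (List.mem_of_mem_take hr), List.map_take, map_take_one hT]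
  simp [columnTableau, List.map_take]

theorem restrict_replicate {T : Filling} (hT : ∀ r ∈ T, r ≠ []) (m : ℕ) :
    restrict T (List.replicate m 1) = columnTableau ((firstColumn T).take m) := by
  induction T generalizing m with
  | nil => simp [restrict, firstColumn, columnTableau]
  | cons r T ih =>
    rw [List.forall_mem_cons] at hT
    cases m with
    | zero => simp [restrict, columnTableau]
    | succ m =>
      rcases r with _ | ⟨a, r⟩
      · exact absurd rfl hT.1
      · rw [List.replicate_succ, restrict, List.zipWith_cons_cons, ← restrict, ih hT.2]
        rfl

theorem shapeLE_replicate_iff {T : Filling} (hT : ∀ r ∈ T, r ≠ []) (m : ℕ) :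
    ShapeLE (List.replicate m 1) (shape T) ↔ m ≤ T.length := by
  constructor
  · intro h
    cases m with
    | zero => simp
    | succ m =>
      by_contra hlt
      have := h m
      rw [List.getD_eq_default (shape T) 0 (by simp [shape]; omega),
        List.getD_eq_getElem _ _ (by simp)] at this
      simp at this
  · intro h i
    rcases lt_or_ge i m with hi | hi
    · have hi' : i < T.length := hi.trans_le h
      rw [List.getD_eq_getElem _ _ (by simpa using hi),
        List.getD_eq_getElem _ _ (by simpa [shape] using hi')]
      simpa [shape, Nat.one_le_iff_ne_zero] using hT _ (List.getElem_mem hi')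
    · rw [List.getD_eq_default _ _ (by simpa using hi)]
      exact Nat.zero_le _

theorem shapeLE_and_restrict_iff {T : Filling} (hT : ∀ r ∈ T, r ≠ []) (K : List ℤ) :
    (ShapeLE (List.replicate K.length 1) (shape T) ∧
      restrict T (List.replicate K.length 1) = columnTableau K) ↔
      ∃ P, firstColumn T = K ++ P := by
  rw [shapeLE_replicate_iff hT, restrict_replicate hT, columnTableau_injective.eq_iff]
  constructor
  · rintro ⟨-, h⟩
    exact ⟨(firstColumn T).drop K.length, by
      conv_lhs => rw [← List.take_append_drop K.length (firstColumn T), h]⟩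
  · rintro ⟨P, h⟩
    rw [← length_firstColumn hT, h]
    simp

theorem rowWord_mapIdx_drop_take {T : Filling} (hT : ∀ r ∈ T, r ≠ []) (m : ℕ) :
    rowWord (T.mapIdx fun i r => (r.take 1).drop ((List.replicate m 1).getD i 0)) =
      ((firstColumn T).drop m).reverse := by
  induction T generalizing m with
  | nil => simp [firstColumn, rowWord]
  | cons r T ih =>
    rw [List.forall_mem_cons] at hT
    rcases r with _ | ⟨a, r⟩
    · exact absurd rfl hT.1
    rw [List.mapIdx_cons, rowWord_cons, firstColumn_cons_cons]
    cases m with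
    | zero => simpa using ih hT.2 0
    | succ m => simpa [List.replicate_succ] using ih hT.2 m

/-- With first part `1`, the shape and agreement conditions say that the first column of `U` is an
initial segment of that of `T`, and the rest `P` is what the catabolism moves. -/
theorem colCatabolizable_cons_iff {n : ℕ} {η : List ℕ} {U T : Filling} (hU : IsTableau U)
    (hT : IsTableau T) : ColCatabolizable n (1 :: η) U T ↔
      ∃ P, firstColumn T = firstColumn U ++ P ∧
        ColCatabolizable n η (tailColumns U) (insertionTableau
          ((rowWord (east 1 T)) ++ (P.map ((-(n : ℤ)) + ·)).reverse)) := by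
  rw [ColCatabolizable]
  rw [map_take_one hU.1, shape_columnTableau, restrict_replicate hU.1, List.take_length,
    ← and_assoc, shapeLE_and_restrict_iff hT.1, ← exists_and_right]
  refine exists_congr fun P => and_congr_right fun h => ?_
  rw [ccat, product, rowWord_translate, rowWord_mapIdx_drop_take hT.1, h, List.drop_left,
    List.map_reverse]
  rfl

theorem mapIdx_drop (T : Filling) (k : ℕ) :
    (T.mapIdx fun i r => r.drop ((List.replicate k 1).getD i 0)) =
      east 1 (T.take k) ++ T.drop k := by
  induction T generalizing k with
  | nil => simp [east]
  | cons r T ih =>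
    rw [List.mapIdx_cons]
    cases k with
    | zero => simpa [east] using ih 0
    | succ k => simpa [east, List.replicate_succ] using ih k

theorem RowCatabolizable.exists_of_cons {n k : ℕ} {η : List ℕ} {Q : List ℤ} {T : Filling}
    (hT : IsTableau T) (hk : k ≤ Q.length)
    (h : RowCatabolizable n (k :: η) (columnTableau Q) T) :
    firstColumn (T.take k) = Q.take k ∧
      RowCatabolizable n η (columnTableau (Q.drop k)) (insertionTableau
        ((rowWord (east 1 (T.take k))).map ((n : ℤ) + ·) ++ rowWord (T.drop k))) := by
  have htake : (columnTableau Q).take k = columnTableau (Q.take k) := List.map_take.symm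
  have hdrop : (columnTableau Q).drop k = columnTableau (Q.drop k) := List.map_drop.symm
  rw [RowCatabolizable] at h
  have hlen : (Q.take k).length = k := by simpa using hk
  have hQ : ∀ r ∈ columnTableau Q, r ≠ [] := by simp [columnTableau]
  have hfc : firstColumn (columnTableau Q) = Q := by
    induction Q with
    | nil => rfl
    | cons q Q ih => simp [columnTableau, firstColumn]
  rw [htake, hdrop, shape_columnTableau, hlen, restrict_replicate hQ, hfc,
    restrict_replicate hT.1, shapeLE_replicate_iff hT.1, rcat] at h
  simp only [mapIdx_drop] at h
  obtain ⟨hlT, h1, h2⟩ := h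
  refine ⟨by rw [firstColumn_take hT.1, columnTableau_injective h1], ?_⟩
  have hl : (east 1 (T.take k)).length = k := by simpa [east] using hlT
  rwa [List.take_left' hl, List.drop_left' hl, product, rowWord_translate] at h2

variable {n : ℕ}

/-! ### Catabolizability of a tableau and of its reading word -/

theorem IsTableau.sublist {S T : Filling} (hT : IsTableau T) (h : S.Sublist T) :
    IsTableau S := by
  rw [isTableau_iff] at hT ⊢
  exact ⟨fun r hr => hT.1 r (h.subset hr), fun r hr => hT.2.1 r (h.subset hr),
    hT.2.2.sublist h⟩

theorem signPass_rowWord {T : Filling} (hT : IsTableau T) :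
    signPass n ⟨rowWord T, []⟩ =
      ⟨(rowWord (east 1 T)).map ((n : ℤ) + ·), firstColumn T⟩ := by
  rw [signPass, columnPass_rowWord hT]

theorem stack_tailColumns {U : Filling} (hU : IsTableau U) (hne : U ≠ [])
    (hs : (stack n U).Pairwise (· < ·)) :
    (stack n (tailColumns U)).Pairwise (· < ·) ∧
      ∀ k ∈ firstColumn U, ∀ q ∈ (stack n (tailColumns U)).map ((n : ℤ) + ·), k < q := by
  rw [stack_eq n hU hne, List.pairwise_append, List.pairwise_map] at hs
  exact ⟨hs.2.1.imp fun h => lt_of_add_lt_add_left h, hs.2.2⟩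

/-- One pass leaves the first column of `U` and raises the others by `n`. Stackability makes this
column inert, and the induction goes on with the tail. -/
theorem final_stack {U : Filling} (hU : IsTableau U) (hs : (stack n U).Pairwise (· < ·)) :
    Final n ⟨rowWord U, []⟩ (stack n U) := by
  refine isTableau_induction
    (p := fun U => (stack n U).Pairwise (· < ·) → Final n ⟨rowWord U, []⟩ (stack n U))
    (fun _ => .refl _) (fun U hU hne ih hs => ?_) hU hs
  obtain ⟨h1, h2⟩ := stack_tailColumns hU hne hs
  have h := ((ih h1).shift n).addPrefix h2
  rw [stack_eq n hU hne]
  refine (later_signPass n _).trans ?_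
  rw [signPass_rowWord hU, ← rowWord_tailColumns]
  simp only [SignState.shift, SignState.addPrefix, List.map_nil, List.append_nil] at h
  exact h

theorem incongruent_map_add_iff {w : List ℤ} :
    Incongruent n (w.map ((n : ℤ) + ·)) ↔ Incongruent n w := by
  rw [Incongruent, map_add_emod_self]

/-- Up to translation, the word of a column catabolism is the word left by a pass followed by the
leftover column `P`. -/
theorem map_add_append_reverse (x P : List ℤ) :
    (x ++ (P.map ((-(n : ℤ)) + ·)).reverse).map ((n : ℤ) + ·) =
      x.map ((n : ℤ) + ·) ++ P.reverse := by
  simp [Function.comp_def]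

theorem incongruent_columnCatabolism {T : Filling} (hT : IsTableau T)
    (hi : Incongruent n (rowWord T)) {K P : List ℤ} (h : firstColumn T = K ++ P) :
    Incongruent n (rowWord (east 1 T) ++ (P.map ((-(n : ℤ)) + ·)).reverse) := by
  have h1 := hi.perm (rowWord_perm hT).symm
  rw [← incongruent_map_add_iff, map_add_append_reverse, Incongruent, List.map_append,
    map_add_emod_self, ← List.map_append]
  rw [h] at h1
  have h2 : Incongruent n (rowWord (east 1 T) ++ P) :=
    h1.sublist (((List.sublist_append_right K P).append_left _).map _)
  exact h2.perm (P.reverse_perm.symm.append_left _)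

theorem incongruent_insertionTableau {w : List ℤ} (hw : Incongruent n w) :
    Incongruent n (rowWord (insertionTableau w)) :=
  hw.perm (KnuthEquiv.perm (knuthEquiv_insertionTableau hw.nodup))

theorem catabolizes_insertionTableau_iff {w Q : List ℤ} {η : List ℕ} (hw : Incongruent n w) :
    Catabolizes n η ⟨rowWord (insertionTableau w), []⟩ Q ↔ Catabolizes n η ⟨w, []⟩ Q :=
  (catabolizes_knuthEquiv_iff (knuthEquiv_insertionTableau hw.nodup) hw).symm

theorem colCatabolizable_iff {U T : Filling} (hU : IsTableau U)
    (hs : (stack n U).Pairwise (· < ·)) (hT : IsTableau T) (hi : Incongruent n (rowWord T)) :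
    ColCatabolizable n (List.replicate (columns U).length 1) U T ↔
      Catabolizes n (conjShape U) ⟨rowWord T, []⟩ (stack n U) := by
  refine isTableau_induction (p := fun U => (stack n U).Pairwise (· < ·) → ∀ {T : Filling},
    IsTableau T → Incongruent n (rowWord T) →
      (ColCatabolizable n (List.replicate (columns U).length 1) U T ↔
        Catabolizes n (conjShape U) ⟨rowWord T, []⟩ (stack n U)))
    (fun _ T hT _ => ?_) (fun U hU hne ih hs T hT hi => ?_) hU hs hT hi
  · change [] = [] ∧ T = [] ↔ Catabolizes n [] ⟨rowWord T, []⟩ []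
    refine ⟨fun h => ?_, fun h => ⟨rfl, eq_nil_of_rowWord_eq_nil hT ?_⟩⟩
    · rw [h.2]
      exact ⟨.refl _, by simp⟩
    -- The number of letters is constant, so an empty final column forces an empty word.
    · have := Later.length_letters h.1
      exact List.eq_nil_of_length_eq_zero (by simpa [SignState.letters] using this.symm)
  · obtain ⟨h1, h2⟩ := stack_tailColumns hU hne hs
    rw [columns_eq_cons hU hne, List.length_cons, List.replicate_succ,
      colCatabolizable_cons_iff hU hT, conjShape_eq hU hne, stack_eq n hU hne]
    have key : ∀ {P}, firstColumn T = firstColumn U ++ P →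
        (ColCatabolizable n (List.replicate (columns (tailColumns U)).length 1) (tailColumns U)
          (insertionTableau (rowWord (east 1 T) ++ (P.map ((-(n : ℤ)) + ·)).reverse)) ↔
        Catabolizes n (conjShape (tailColumns U))
          ⟨(rowWord (east 1 T)).map ((n : ℤ) + ·), P⟩
          ((stack n (tailColumns U)).map ((n : ℤ) + ·))) := fun {P} hP => by
      have hw := incongruent_columnCatabolism hT hi hP
      have hPs : P.Pairwise (· < ·) := by
        have := firstColumn_sorted hT
        rw [hP] at this
        exact this.sublist (List.sublist_append_right _ _)
      rw [ih h1 (isTableau_insertionTableau _) (incongruent_insertionTableau hw),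
        catabolizes_insertionTableau_iff hw, ← catabolizes_map_add_iff (n : ℤ),
        map_add_append_reverse, catabolizes_append_reverse_iff hPs]
    have hpass := signPass_rowWord (n := n) hT
    constructor
    · rintro ⟨P, hP, h⟩
      refine ((key hP).1 h).of_later h2 ?_ ?_
      · have := later_signPass n ⟨rowWord T, []⟩
        rwa [hpass, hP] at this
      · rw [hpass, hP]
        exact .refl _
    · intro h
      obtain ⟨K, P, Q', hK, hQ, hc, h⟩ := h.exists_signPass
        (by simpa [SignState.letters] using hi) .nil
      -- The prefix in place has the length of the first column of `U`, so it is that column.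
      obtain ⟨rfl, rfl⟩ := List.append_inj hQ hK.symm
      rw [hpass] at hc h
      exact ⟨P, hc, (key hc).2 h⟩

/-- Inserting only the top `k` rows puts the first `k` entries of `Q` in place, and the remaining
word is that of the row catabolism. As this may occur before the pass ends, `Catabolizes.of_later`
gives inequalities, which suffice for this direction. -/
theorem RowCatabolizable.catabolizes {η : List ℕ} {Q : List ℤ} {T : Filling}
    (hQ : Q.Pairwise (· < ·)) (hη : η.sum = Q.length) (hT : IsTableau T)
    (hi : Incongruent n (rowWord T)) (h : RowCatabolizable n η (columnTableau Q) T) :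
    Catabolizes n η ⟨rowWord T, []⟩ Q := by
  induction η generalizing Q T with
  | nil =>
    obtain rfl : Q = [] := List.eq_nil_of_length_eq_zero (by simpa using hη.symm)
    obtain rfl : T = [] := h.2
    exact ⟨.refl _, by simp⟩
  | cons k η ih =>
    rw [List.sum_cons] at hη
    obtain ⟨h1, h2⟩ := h.exists_of_cons hT (by omega)
    have hTk := hT.sublist (List.take_sublist k T)
    have hsplit : rowWord T = rowWord (T.drop k) ++ rowWord (T.take k) := by
      rw [← rowWord_append, List.take_append_drop]
    have hw : Incongruent n
        ((rowWord (east 1 (T.take k))).map ((n : ℤ) + ·) ++ rowWord (T.drop k)) := by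
      rw [Incongruent, List.map_append, map_add_emod_self, ← List.map_append]
      rw [hsplit] at hi
      have h3 := hi.perm ((rowWord_perm hTk).symm.append_left _)
      have h4 : Incongruent n (rowWord (T.drop k) ++ rowWord (east 1 (T.take k))) :=
        h3.sublist (((List.sublist_append_left _ _).append_left _).map _)
      exact h4.perm List.perm_append_comm
    have h5 := ih (hQ.sublist (List.drop_sublist k Q)) (by simp; omega)
      (isTableau_insertionTableau _) (incongruent_insertionTableau hw) h2
    rw [catabolizes_insertionTableau_iff hw] at h5
    have hstate := signStep_iterate_append (n := n) (rowWord (T.drop k)) (rowWord (T.take k)) []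
    rw [columnPass_rowWord hTk, h1, ← hsplit] at hstate
    have hK : ∀ a ∈ Q.take k, ∀ q ∈ Q.drop k, a < q := by
      rw [← List.take_append_drop k Q, List.pairwise_append] at hQ
      exact hQ.2.2
    have hprefix : SignState.addPrefix (Q.take k)
        ⟨(rowWord (east 1 (T.take k))).map ((n : ℤ) + ·) ++ rowWord (T.drop k), []⟩ =
        (signStep n)^[(rowWord (T.take k)).length] ⟨rowWord T, []⟩ := by
      rw [hstate, SignState.addPrefix, List.append_nil]
    have := h5.of_later (s := ⟨rowWord T, []⟩) hK ⟨_, hprefix⟩ (by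
      rw [hprefix, signPass_eq_iterate]
      exact later_iterate_of_le (by simp [hsplit]))
    rwa [List.length_take, min_eq_left (by omega), List.take_append_drop] at this

theorem sum_conjShape {U : Filling} : (conjShape U).sum = (stack n U).length := by
  rw [stack, List.length_flatten, conjShape]
  congr 1
  refine List.ext_getElem (by simp) fun i _ _ => ?_
  simp

theorem IsStackable.sorted {U : Filling} (h : IsStackable n U) :
    (stack n U).Pairwise (· < ·) := by
  have := (isTableau_iff.1 h).2.2
  rw [columnTableau, List.pairwise_map] at this
  exact this.imp fun h => h.1

theorem IsAffineTableau.incongruent {T : Filling} (h : IsAffineTableau n T) :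
    Incongruent n (rowWord T) :=
  List.pairwise_map.2 h.2.2

/-! ### Paths between reading words -/

/-- The state is read as its word followed by the column from south to north. Column insertion is a
chain of Knuth transformations that brings a bumped letter to the right end, from where a corotation
sends it to the front. -/
theorem later_path {s s' : SignState} (h : Later n s s') (hi : Incongruent n s.letters)
    (hs : s.col.Pairwise (· < ·)) :
    Relation.ReflTransGen (fun v v' => KnuthTransformation v v' ∨ CorotationEdge n v v')
      (s.word ++ s.col.reverse) (s'.word ++ s'.col.reverse) := by
  obtain ⟨c, rfl⟩ := h
  induction c with
  | zero => exact .refl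
  | succ c ih =>
    refine ih.trans ?_
    have hl : Later n s ((signStep n)^[c] s) := ⟨c, rfl⟩
    have hi := hl.incongruent hi
    have hs := hl.sorted hs
    rw [Function.iterate_succ_apply']
    generalize (signStep n)^[c] s = t at hi hs
    rcases eq_nil_or_concat t with ⟨P, rfl⟩ | ⟨x, a, P, rfl⟩
    · exact .refl
    · have ha : a ∉ P := fun h => by
        have := hi.nodup
        simp [SignState.letters, List.nodup_append, h] at this
      have h1 := (knuthEquiv_insertIntoColumn hs ha).append_left x
      rw [signStep_concat]
      simp only [List.append_assoc, List.singleton_append]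
      refine Relation.ReflTransGen.trans
        (Relation.ReflTransGen.mono (fun _ _ h => .inl h) _ _ h1) ?_
      cases (insertIntoColumn a P).2 with
      | none => simpa using Relation.ReflTransGen.refl
      | some b =>
        refine .single (.inr ?_)
        simpa using CorotationEdge.mk (n := n) (x ++ (insertIntoColumn a P).1.reverse) b

/-- A path of Knuth transformations, corotation-edges and ascent-edges. -/
abbrev AscentPath (n : ℕ) : List ℤ → List ℤ → Prop :=
  Relation.ReflTransGen
    (fun v v' => KnuthTransformation v v' ∨ CorotationEdge n v v' ∨ AscentEdge v v')

theorem KnuthEquiv.ascentPath {v w : List ℤ} (h : KnuthEquiv v w) : AscentPath n v w :=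
  Relation.ReflTransGen.mono (fun _ _ h => .inl h) _ _ h

theorem ascentPath_rotate (x z : List ℤ) :
    AscentPath n (z ++ x) (x.map ((n : ℤ) + ·) ++ z) := by
  induction x using List.reverseRecOn generalizing z with
  | nil => simpa using Relation.ReflTransGen.refl
  | append_singleton x a ih =>
    refine .head (.inr (.inl (?_ : CorotationEdge n _ (((n : ℤ) + a) :: z ++ x)))) ?_
    · simpa using CorotationEdge.mk (n := n) (z ++ x) a
    · simpa using ih (((n : ℤ) + a) :: z)

theorem ascentPath_move_right {c : ℤ} {K : List ℤ} (hK : ∀ k ∈ K, k < c) (u v : List ℤ) :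
    AscentPath n (u ++ c :: (K ++ v)) (u ++ K ++ c :: v) := by
  induction K generalizing u with
  | nil => simpa using Relation.ReflTransGen.refl
  | cons k K ih =>
    rw [List.forall_mem_cons] at hK
    refine .head (.inr (.inr (?_ : AscentEdge _ ((u ++ [k]) ++ c :: (K ++ v))))) ?_
    · simpa using AscentEdge.mk u (K ++ v) hK.1
    · simpa using ih hK.2 (u ++ [k])

/-- Only corotations notice `K`: they put `n + a` in front of it, and ascents move it back since `K`
lies below `n + a`. The bound persists because letters are only raised. -/
theorem AscentPath.append_left {K u v : List ℤ} (h : AscentPath n u v)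
    (hK : ∀ k ∈ K, ∀ a ∈ u, k < n + a) : AscentPath n (K ++ u) (K ++ v) := by
  suffices AscentPath n (K ++ u) (K ++ v) ∧ ∀ k ∈ K, ∀ a ∈ v, k < n + a from this.1
  induction h with
  | refl => exact ⟨.refl, hK⟩
  | tail _ hstep ih =>
    obtain ⟨ih, hb⟩ := ih
    rcases hstep with hstep | hstep | hstep
    · exact ⟨ih.tail (.inl (by simpa using hstep.append K [])),
        fun k hk a ha => hb k hk a (hstep.perm.symm.subset ha)⟩
    · obtain ⟨z, a⟩ := hstep
      refine ⟨ih.trans ?_, fun k hk b hb' => ?_⟩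
      · have h1 := ascentPath_rotate (n := n) [a] (K ++ z)
        have h2 := ascentPath_move_right (n := n) (fun k hk => hb k hk a (by simp)) [] z
        simp only [List.append_assoc, List.map_cons, List.map_nil, List.singleton_append,
          List.nil_append] at h1 h2
        exact h1.trans h2
      · rcases List.mem_cons.1 hb' with rfl | hb'
        · have := hb k hk a (by simp)
          omega
        · exact hb k hk b (by simp [hb'])
    · obtain ⟨s, t, hab⟩ := hstep
      refine ⟨ih.tail (.inr (.inr ?_)), fun k hk a ha => hb k hk a ?_⟩
      · simpa using AscentEdge.mk (K ++ s) t hab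
      · simp only [List.mem_append, List.mem_cons] at ha ⊢
        tauto

theorem ColCatabolizable.ascentPath {U T : Filling} (hU : IsTableau U)
    (hUn : (rowWord U).Nodup) (hs : (stack n U).Pairwise (· < ·)) (hT : IsTableau T)
    (hi : Incongruent n (rowWord T))
    (h : ColCatabolizable n (List.replicate (columns U).length 1) U T) :
    AscentPath n (rowWord U) (rowWord T) := by
  refine isTableau_induction (p := fun U => (rowWord U).Nodup → (stack n U).Pairwise (· < ·) →
    ∀ {T : Filling}, IsTableau T → Incongruent n (rowWord T) →
      ColCatabolizable n (List.replicate (columns U).length 1) U T →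
        AscentPath n (rowWord U) (rowWord T))
    (fun _ _ T _ _ h => ?_) (fun U hU hne ih hUn hs T hT hi h => ?_) hU hUn hs hT hi h
  · obtain rfl : T = [] := h.2
    exact .refl
  · obtain ⟨h1, h2⟩ := stack_tailColumns hU hne hs
    rw [columns_eq_cons hU hne, List.length_cons, List.replicate_succ,
      colCatabolizable_cons_iff hU hT] at h
    obtain ⟨P, hP, h⟩ := h
    have hw := incongruent_columnCatabolism hT hi hP
    have hUn' : (rowWord (tailColumns U)).Nodup := by
      rw [rowWord_tailColumns]
      exact (List.nodup_append.1 ((rowWord_perm hU).nodup_iff.2 hUn)).1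
    have hpath := (ih hUn' h1 (isTableau_insertionTableau _)
      (incongruent_insertionTableau hw) h).trans
        (KnuthEquiv.ascentPath (knuthEquiv_insertionTableau hw.nodup).symm)
    have hlt : ∀ k ∈ (firstColumn U).reverse, ∀ a ∈ rowWord (tailColumns U), k < n + a := by
      intro k hk a ha
      -- By stackability `K` lies below the stacked tail, and letters at the start of a run dominate
      -- letters of its result.
      exact ((final_stack (isTableau_tailColumns hU) h1).shift n).forall_lt h2 k
        (List.mem_reverse.1 hk) _ (by simpa [SignState.letters, SignState.shift] using ha)
    have h3 := KnuthEquiv.ascentPath (n := n) (knuthEquiv_rowWord hU hUn)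
    rw [← rowWord_tailColumns] at h3
    -- Corotating the lowered copy of `P` from the end to the front restores it on the left of the
    -- first column of `U`, which completes the first column of `T`.
    have h4 := ascentPath_rotate (n := n) (P.map ((-(n : ℤ)) + ·)).reverse
      ((firstColumn U).reverse ++ rowWord (east 1 T))
    have h5 := KnuthEquiv.ascentPath (n := n) (knuthEquiv_rowWord hT hi.nodup).symm
    rw [hP] at h5
    refine h3.trans ((AscentPath.append_left hpath hlt).trans (Relation.ReflTransGen.trans ?_ h5))
    simpa [Function.comp_def] using h4

end AffineTableaux

/-! ### The proposition -/

theorem propositionp (n : ℕ) (U : Filling) (hU : IsAffineTableau n U) (hstack : IsStackable n U)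
    (T : Filling) (hT : IsAffineTableau n T) :
    -- (ii), (iii) and (iv) are equivalent
    ((signPTableau n T = signPTableau n U ∧ WordCatabolizable n (conjShape U) (rowWord T)) ↔
      (signPTableau n T = signPTableau n U ∧ WordCatabolizable n (conjShape U) (colWord T))) ∧
    ((signPTableau n T = signPTableau n U ∧ WordCatabolizable n (conjShape U) (colWord T)) ↔
      ColCatabolizable n (List.replicate (columns U).length 1) U T) ∧
    -- (i) implies (ii)
    (RowCatabolizable n (conjShape U) (columnTableau (signPTableau n U)) T →
      (signPTableau n T = signPTableau n U ∧ WordCatabolizable n (conjShape U) (rowWord T))) ∧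
    -- any of (i)-(iv) implies (v)
    ((RowCatabolizable n (conjShape U) (columnTableau (signPTableau n U)) T ∨
        (signPTableau n T = signPTableau n U ∧ WordCatabolizable n (conjShape U) (rowWord T)) ∨
        (signPTableau n T = signPTableau n U ∧ WordCatabolizable n (conjShape U) (colWord T)) ∨
        ColCatabolizable n (List.replicate (columns U).length 1) U T) →
      (Relation.ReflTransGen (fun v v' => KnuthTransformation v v' ∨ CorotationEdge n v v')
          (rowWord T) (rowWord (columnTableau (signPTableau n U))) ∧
        Relation.ReflTransGen
          (fun v v' => KnuthTransformation v v' ∨ CorotationEdge n v v' ∨ AscentEdge v v')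
          (rowWord U) (rowWord T))) := by
  have hs := hstack.sorted
  have hi := hT.incongruent
  have hsU : signPTableau n U = stack n U := signP_eq_of_final (final_stack hU.1 hs)
  rw [hsU]
  have hKE := knuthEquiv_rowWord_colWord hT.1 hi.nodup
  have hic := hi.perm (KnuthEquiv.perm hKE)
  have hPT : signP n (colWord T) = signPTableau n T := by
    -- With `η = []` there is no condition on passes, so only the final column is transported along
    -- the Knuth equivalence.
    have h1 := (catabolizes_iff (η := []) hi).2 ⟨rfl, fun j h h' => by simp at h'; omega⟩
    exact signP_eq_of_final ((catabolizes_knuthEquiv_iff hKE hi).1 h1).1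
  have h2 : (signPTableau n T = stack n U ∧ WordCatabolizable n (conjShape U) (rowWord T)) ↔
      Catabolizes n (conjShape U) ⟨rowWord T, []⟩ (stack n U) := (catabolizes_iff hi).symm
  have h3 : (signPTableau n T = stack n U ∧ WordCatabolizable n (conjShape U) (colWord T)) ↔
      Catabolizes n (conjShape U) ⟨rowWord T, []⟩ (stack n U) := by
    rw [catabolizes_knuthEquiv_iff hKE hi, catabolizes_iff hic, hPT]
  have h4 := colCatabolizable_iff hU.1 hs hT.1 hi
  have h1 := RowCatabolizable.catabolizes (n := n) (η := conjShape U) hs sum_conjShape hT.1 hi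
  rw [h2, h3, h4]
  refine ⟨.rfl, .rfl, h1, fun h => ?_⟩
  have h : Catabolizes n (conjShape U) ⟨rowWord T, []⟩ (stack n U) := by
    rcases h with h | h | h | h
    exacts [h1 h, h, h, h]
  -- The path out of `U` follows the recursion of (iv), so each of the other properties is first
  -- converted to (iv).
  refine ⟨?_, (h4.2 h).ascentPath hU.1 hU.incongruent.nodup hs hT.1 hi⟩
  have := later_path h.1 (by simpa [SignState.letters] using hi) .nil
  rw [rowWord_columnTableau]
  simpa using this
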